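/- Let $d>0$, $l>0$, $\gamma=l$, $a=\gamma+d$, $b=a+l$ and $T=[0,\gamma]\cup[a,b]$, and let $q:T\to\mathbb C$ satisfy $q\in W^1_2[0,\gamma]\cap W^1_2[a,b]$ (i.e. on each segment $q$ is absolutely continuous with square integrable derivative). Consider on $T$ the Dirichlet problem with frozen argument $$-y^{\Delta\Delta}(t)+y(\gamma)q(t)=\lambda\,y(\sigma(t)),\quad t\in T,\qquad y(0)=y(b)=0,$$ where $\sigma$ is the forward jump function of $T$ (so $\sigma(\gamma)=a$ and $\sigma(t)=t$ for all other $t\in T$), $f^\Delta$ is the $\Delta$-derivative ($f^\Delta(\gamma)=(f(a)-f(\gamma))/d$, and $f^\Delta(t)=f'(t)$ for $t\ne\gamma$; $\Delta$-differentiability at $\gamma$ includes continuity from the left), and solutions are functions $y$ that are twice $\Delta$-differentiable on $T$ and of class $C^2$ on each of the two segments. Let $S(\cdot,\lambda)$ and $C(\cdot,\lambda)$ be the solutions of the equation with $S(\gamma)=0$, $S^\Delta(\gamma)=1$ and $C(\gamma)=1$, $C^\Delta(\gamma)=0$, and let $\Delta(\lambda)=S(0,\lambda)C(b,\lambda)-C(0,\lambda)S(b,\lambda)$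 be the characteristic function. Then $\Delta$ is entire, its zeros are exactly the eigenvalues of the problem (the $\lambda$ for which there is a non-zero solution with $y(0)=y(b)=0$), and its zeros, each counted with its multiplicity, can be numbered as a sequence $\{\lambda_n\}_{n\ge0}$ such that $$\lambda_n=\rho_n^2,\qquad \rho_n=\frac{\pi n}{2l}+\frac{2}{d\pi n}+\frac{4l\,\delta_n\,q(0)}{\pi^2n^2}+\frac{\mu_n}{n^2},\qquad n\ge 1,$$ where $\delta_n=\sin\frac{\pi n}{2}$ and $\{\mu_n\}_{n\ge1}\in\ell_2$. -/

import Mathlib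

open Set MeasureTheory

noncomputable section

namespace FrozenArgument

/-! ### Calculus on a closed set `T ⊆ ℝ`.  A function on `T` is represented by a function on `ℝ`;
only its values on `T` matter. -/

/-- The forward jump function of `T`: the infimum of the points of `T` to the right of `t`,
and `t` itself if `t` is the maximum of `T`. -/
def sigma (T : Set ℝ) (t : ℝ) : ℝ :=
  open Classical in if (T ∩ Ioi t).Nonempty then sInf (T ∩ Ioi t) else t

/-- `f` is `Δ`-differentiable at `t` on `T`, with `Δ`-derivative `f'`. -/
def HasDeltaDerivAt (T : Set ℝ) (f : ℝ → ℂ) (f' : ℂ) (t : ℝ) : Prop :=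
  ∀ ε : ℝ, 0 < ε → ∃ δ : ℝ, 0 < δ ∧ ∀ s ∈ T, |s - t| < δ →
    ‖f (sigma T t) - f s - f' * ((sigma T t - s : ℝ) : ℂ)‖ ≤ ε * |sigma T t - s|

/-- The closed set `T = [0, γ] ∪ [a, b]` with `a = γ + d` and `b = a + l`. -/
def twoSegments (γ d l : ℝ) : Set ℝ := Icc 0 γ ∪ Icc (γ + d) (γ + d + l)

/-- `q ∈ W¹₂[α, β]`: `q` is absolutely continuous on `[α, β]` and its derivative is in
`L₂(α, β)`. -/
def MemW12 (q : ℝ → ℂ) (α β : ℝ) : Prop :=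
  ∃ g : ℝ → ℂ, MemLp g 2 (volume.restrict (Ioc α β)) ∧
    ∀ x ∈ Icc α β, q x = q α + ∫ t in α..x, g t

/-! ### The boundary value problem -/

/-- `y` is a solution of `-y^{ΔΔ}(t) + y(γ) q(t) = z y(σ(t))` on `T = [0, γ] ∪ [a, b]`:
it is twice `Δ`-differentiable at every point of `T` (with `u = y^Δ` and `v = y^{ΔΔ}`), it is
twice continuously differentiable on each of the two segments, and the equation holds at every
point of `T`. Continuity of `y^{ΔΔ}` from the left at the right-isolated point `γ` is not
required: together with the equation it would force `z y(a) = z y(γ)`. -/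
def IsSolution (γ d l : ℝ) (q : ℝ → ℂ) (z : ℂ) (y : ℝ → ℂ) : Prop :=
  ContDiffOn ℝ 2 y (Icc 0 γ) ∧ ContDiffOn ℝ 2 y (Icc (γ + d) (γ + d + l)) ∧
  ∃ u v : ℝ → ℂ, ∀ t ∈ twoSegments γ d l,
    HasDeltaDerivAt (twoSegments γ d l) y (u t) t ∧
    HasDeltaDerivAt (twoSegments γ d l) u (v t) t ∧
    -v t + y γ * q t = z * y (sigma (twoSegments γ d l) t)

/-- `z` is an eigenvalue of the Dirichlet problem: there is a solution with `y(0) = y(b) = 0`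
that does not vanish identically on `T`. -/
def IsEigenvalue (γ d l : ℝ) (q : ℝ → ℂ) (z : ℂ) : Prop :=
  ∃ y : ℝ → ℂ, IsSolution γ d l q z y ∧ y 0 = 0 ∧ y (γ + d + l) = 0 ∧
    ∃ t ∈ twoSegments γ d l, y t ≠ 0

/-! ### The characteristic function -/

/-- `cos (ρ x)` with `ρ² = z`; it is even in `ρ`, so the choice of the root is immaterial. -/
def cosRoot (z : ℂ) (x : ℝ) : ℂ := Complex.cos (z ^ (1 / 2 : ℂ) * x)

/-- `sin (ρ x) / ρ` with `ρ² = z`, and its limit `x` for `z = 0`; it is even in `ρ`, so the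
choice of the root is immaterial. -/
def sinRoot (z : ℂ) (x : ℝ) : ℂ :=
  open Classical in
  if z = 0 then (x : ℂ) else Complex.sin (z ^ (1 / 2 : ℂ) * x) / z ^ (1 / 2 : ℂ)

/-- The solution `S(x, z)` on `T` with `S(γ) = 0`, `S^Δ(γ) = 1`; on `[a, b]` it starts from
`S(a) = d`, `S'(a) = 1 - d² z`. -/
def solS (γ d : ℝ) (z : ℂ) (x : ℝ) : ℂ :=
  if x ≤ γ then sinRoot z (x - γ)
  else d * cosRoot z (x - (γ + d)) + (1 - d ^ 2 * z) * sinRoot z (x - (γ + d))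

/-- The solution `C(x, z)` on `T` with `C(γ) = 1`, `C^Δ(γ) = 0`; on `[a, b]` it starts from
`C(a) = 1`, `C'(a) = d (q(γ) - z)`. -/
def solC (γ d : ℝ) (q : ℝ → ℂ) (z : ℂ) (x : ℝ) : ℂ :=
  if x ≤ γ then cosRoot z (x - γ) + ∫ t in γ..x, sinRoot z (x - t) * q t
  else cosRoot z (x - (γ + d)) + d * (q γ - z) * sinRoot z (x - (γ + d))
    + ∫ t in (γ + d)..x, sinRoot z (x - t) * q t

/-- The characteristic function: the determinant of the linear system for `(A, B)` that the
boundary conditions `y(0) = y(b) = 0` impose on `y = A S + B C`. -/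
def charFun (γ d l : ℝ) (q : ℝ → ℂ) (z : ℂ) : ℂ :=
  Matrix.det !![solS γ d z 0, solC γ d q z 0;
    solS γ d z (γ + d + l), solC γ d q z (γ + d + l)]

/-- The sequence `ev 0, ev 1, …` is the spectrum: it lists the zeros of the characteristic
function, each as many times as its multiplicity. -/
def IsSpectrum (γ d l : ℝ) (q : ℝ → ℂ) (ev : ℕ → ℂ) : Prop :=
  ∀ z : ℂ, {n : ℕ | ev n = z}.encard = analyticOrderAt (charFun γ d l q) z

end FrozenArgument

end

/-!
Write `z = ρ²`. In the case `γ = l` the characteristic function is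

  `d² ρ sin (2 l ρ) / 2 - d cos (2 l ρ) + d² sin (ρ l) q(0) / ρ + (smaller terms)`,

and each part of the theorem is read off from this function.

*Entireness.* In `ρ` everything is visibly entire and even, and an entire function of `ρ` that
depends only on `ρ²` is entire in `z` (`differentiable_of_comp_sq`).

*Eigenvalues.* Variation of constants (`eq_segSol`) shows that the solutions of the equation are
exactly the combinations `A S + B C` (`IsSolution.exists_eq`, `isSolution_add`), so that an
eigenvalue is a point where the determinant of the boundary conditions vanishes
(`isEigenvalue_iff`).

*Numbering.* The first term, `d² z sin (2 l ρ) / (2 ρ)` as a function of `z`, has the simple zeros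
`(π n / 2 l)²`, `n ≥ 0`. It dominates the rest on the circles `|ρ| = π (n + 1/2) / (2 l)` for large
`n`, because `|sin w|` is at least a multiple of `exp |Im w|` away from the zeros of the sine.
Rouché's theorem (`rouche`), proved from the argument principle for entire functions, gives `n + 1`
zeros inside such a circle, hence one simple zero between consecutive ones
(`exists_enumeration`).

*Asymptotics.* For the root `ρ` of the `n`-th zero put `w = 2 l ρ - π n`. Comparison with the first
term gives `w = O(1/n)` (`exists_spectrum_approx`). Inserting this in the equation `charFun = 0` and
solving for `w` in the first term gives the two explicit corrections
(`equation_of_charFun_eq_zero`, `isBigO_root_sub`). The value `q(0)` appears through an integration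
by parts in `∫ sin (ρ t) q(t) dt`; what this leaves over is the integral of `cos (ρ t) q'(t)`, which
up to `O(1/n)` is a Fourier coefficient of a square integrable function and so is square summable
(`memℓp_integral_cos`).
-/

namespace FrozenArgument

open Complex Filter Topology Metric Asymptotics

/-! ### Counting zeros of entire functions -/

lemma analyticOrderAt_ne_top_of_entire {f : ℂ → ℂ} (hf : Differentiable ℂ f) {w : ℂ}
    (hw : f w ≠ 0) (z : ℂ) : analyticOrderAt f z ≠ ⊤ := by
  have hfa : AnalyticOnNhd ℂ f univ := fun x _ => hf.analyticAt x
  refine hfa.analyticOrderAt_ne_top_of_isPreconnected isPreconnected_univ (mem_univ w)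
    (mem_univ z) ?_
  rw [(hf.analyticAt w).analyticOrderAt_eq_zero.2 hw]
  simp

lemma differentiable_dslope {f : ℂ → ℂ} (hf : Differentiable ℂ f) (a : ℂ) :
    Differentiable ℂ (dslope f a) := by
  rw [← differentiableOn_univ] at hf ⊢
  exact (Complex.differentiableOn_dslope univ_mem).2 hf

/-- An entire function splits off the full power of `z - a` globally. -/
lemma exists_eq_pow_mul_of_analyticOrderAt {f : ℂ → ℂ} (hf : Differentiable ℂ f) {a : ℂ} {m : ℕ}
    (hm : analyticOrderAt f a = m) :
    ∃ g : ℂ → ℂ, Differentiable ℂ g ∧ g a ≠ 0 ∧ ∀ z, f z = (z - a) ^ m * g z := by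
  induction m generalizing f with
  | zero =>
    refine ⟨f, hf, ?_, by simp⟩
    exact (hf.analyticAt a).analyticOrderAt_eq_zero.1 (by simpa using hm)
  | succ m ih =>
    have h0 : f a = 0 := by
      refine apply_eq_zero_of_analyticOrderAt_ne_zero (𝕜 := ℂ) ?_
      rw [hm]
      exact_mod_cast Nat.succ_ne_zero m
    have hd := differentiable_dslope hf a
    have hfac : f = (fun z => z - a) * dslope f a := by
      funext z
      simpa using (sub_smul_dslope_of_zero h0 z).symm
    have hord : analyticOrderAt (dslope f a) a = m := by
      have h1 : analyticOrderAt f a = 1 + analyticOrderAt (dslope f a) a := by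
        conv_lhs => rw [hfac]
        rw [analyticOrderAt_mul (by fun_prop) (hd.analyticAt a)]
        congr 1
        exact analyticOrderAt_id_sub_const_self
      rw [hm] at h1
      push_cast at h1
      rw [add_comm] at h1
      exact ((ENat.add_right_injective_of_ne_top ENat.one_ne_top) h1).symm
    obtain ⟨g, hg, hga, hgf⟩ := ih hd hord
    refine ⟨g, hg, hga, fun z => ?_⟩
    rw [pow_succ', mul_assoc, ← hgf z]
    exact congrFun hfac z

/-- An entire function is the product of the powers of `z - a` over a finite set of points `a`,
with the exponents given by its orders, and of an entire function without zeros in that set. -/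
lemma exists_eq_prod_mul {f : ℂ → ℂ} (hf : Differentiable ℂ f)
    (htop : ∀ z, analyticOrderAt f z ≠ ⊤) (Z : Finset ℂ) :
    ∃ g : ℂ → ℂ, Differentiable ℂ g ∧ (∀ a ∈ Z, g a ≠ 0) ∧
      ∀ z, f z = (∏ a ∈ Z, (z - a) ^ analyticOrderNatAt f a) * g z := by
  induction Z using Finset.induction_on with
  | empty => exact ⟨f, hf, by simp, by simp⟩
  | insert b Z hb ih =>
    obtain ⟨g, hg, hgZ, hfg⟩ := ih
    set p : ℂ → ℂ := fun z => ∏ a ∈ Z, (z - a) ^ analyticOrderNatAt f a with hp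
    have hpd : Differentiable ℂ p := by
      intro z
      simp only [hp]
      fun_prop
    have hpb : p b ≠ 0 := by
      refine Finset.prod_ne_zero_iff.2 fun a ha => pow_ne_zero _ (sub_ne_zero.2 ?_)
      rintro rfl
      exact hb ha
    have hford : analyticOrderAt g b = analyticOrderNatAt f b := by
      have h1 : analyticOrderAt f b = analyticOrderAt g b := by
        have : f = p * g := funext hfg
        conv_lhs => rw [this]
        rw [analyticOrderAt_mul (hpd.analyticAt b) (hg.analyticAt b),
          (hpd.analyticAt b).analyticOrderAt_eq_zero.2 hpb, zero_add]
      rw [← h1]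
      exact (Nat.cast_analyticOrderNatAt (htop b)).symm
    obtain ⟨h, hh, hhb, hgh⟩ := exists_eq_pow_mul_of_analyticOrderAt hg hford
    refine ⟨h, hh, ?_, fun z => ?_⟩
    · intro a ha
      rcases Finset.mem_insert.1 ha with rfl | ha
      · exact hhb
      · have := hgZ a ha
        rw [hgh] at this
        exact right_ne_zero_of_mul this
    · rw [Finset.prod_insert hb, hfg z, hgh z]
      ring

/-- The argument principle for an entire function on a disk centred at the origin. -/
lemma circleIntegral_logDeriv_eq {f : ℂ → ℂ} (hf : Differentiable ℂ f) {R : ℝ} (hR : 0 < R)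
    (hne : ∀ z, ‖z‖ = R → f z ≠ 0) {Z : Finset ℂ} (hZ : ∀ a, a ∈ Z ↔ ‖a‖ < R ∧ f a = 0) :
    (∮ z in C(0, R), logDeriv f z) = 2 * Real.pi * I * (∑ a ∈ Z, analyticOrderNatAt f a : ℕ) := by
  have hR' : f (R : ℂ) ≠ 0 := hne _ (by simp [abs_of_pos hR])
  obtain ⟨g, hg, hgZ, hfg⟩ := exists_eq_prod_mul hf (analyticOrderAt_ne_top_of_entire hf hR') Z
  set m : ℂ → ℕ := analyticOrderNatAt f with hm
  have hg0 : ∀ z ∈ closedBall (0 : ℂ) R, g z ≠ 0 := by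
    intro z hz h0
    have hfz : f z = 0 := by rw [hfg, h0, mul_zero]
    rcases (mem_closedBall_zero_iff.1 hz).lt_or_eq with h | h
    · exact hgZ z ((hZ z).2 ⟨h, hfz⟩) h0
    · exact hne z h hfz
  have hgd : ∀ z ∈ closedBall (0 : ℂ) R, DifferentiableAt ℂ (logDeriv g) z := fun z hz =>
    ((hg.analyticAt z).deriv.differentiableAt).div (hg z) (hg0 z hz)
  have hsub : ∀ z, ‖z‖ = R → ∀ a ∈ Z, z - a ≠ 0 := by
    intro z hz a ha h
    rw [sub_eq_zero] at h
    subst h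
    exact (((hZ z).1 ha).1).ne hz
  have hlog : EqOn (logDeriv f) (fun z => (∑ a ∈ Z, (m a : ℂ) * (z - a)⁻¹) + logDeriv g z)
      (sphere 0 R) := by
    intro z hz
    have hzR : ‖z‖ = R := by simpa using hz
    have h1 : f = fun z => (∏ a ∈ Z, (z - a) ^ m a) * g z := funext hfg
    have h2 : logDeriv f z = logDeriv (fun z => ∏ a ∈ Z, (z - a) ^ m a) z + logDeriv g z := by
      conv_lhs => rw [h1]
      refine logDeriv_mul z ?_ (hg0 z (by simp [hzR])) ?_ (hg z)
      · exact Finset.prod_ne_zero_iff.2 fun a ha => pow_ne_zero _ (hsub z hzR a ha)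
      · fun_prop
    have h3 : logDeriv (fun z => ∏ a ∈ Z, (z - a) ^ m a) z = ∑ a ∈ Z, (m a : ℂ) * (z - a)⁻¹ := by
      have h4 := logDeriv_prod (s := Z) (f := fun a (z : ℂ) => (z - a) ^ m a) (x := z)
        (fun a ha => pow_ne_zero _ (hsub z hzR a ha)) (fun a _ => by fun_prop)
      rw [h4]
      refine Finset.sum_congr rfl fun a ha => ?_
      rw [logDeriv_fun_pow (by fun_prop)]
      simp [logDeriv_apply]
    rw [h2, h3]
  have hint : ∀ a ∈ Z, CircleIntegrable (fun z => (m a : ℂ) * (z - a)⁻¹) 0 R := by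
    intro a ha
    refine ContinuousOn.circleIntegrable hR.le ?_
    refine continuousOn_const.mul (ContinuousOn.inv₀ (by fun_prop) fun z hz => ?_)
    exact hsub z (by simpa using hz) a ha
  have hgint : CircleIntegrable (logDeriv g) 0 R :=
    ContinuousOn.circleIntegrable hR.le fun z hz =>
      (hgd z (sphere_subset_closedBall hz)).continuousAt.continuousWithinAt
  rw [circleIntegral.integral_congr hR.le hlog,
    circleIntegral.integral_add (by
      have := CircleIntegrable.sum Z hint
      convert this using 1
      funext z; simp) hgint,
    circleIntegral.integral_fun_sum hint]
  have hgz : (∮ z in C(0, R), logDeriv g z) = 0 := by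
    refine circleIntegral_eq_zero_of_differentiable_on_off_countable hR.le countable_empty
      (fun z hz => (hgd z hz).continuousAt.continuousWithinAt)
      fun z hz => hgd z (ball_subset_closedBall hz.1)
  rw [hgz, add_zero]
  push_cast
  rw [Finset.mul_sum]
  refine Finset.sum_congr rfl fun a ha => ?_
  rw [circleIntegral.integral_const_mul, circleIntegral.integral_sub_inv_of_mem_ball]
  · ring
  · simpa using ((hZ a).1 ha).1

/-- **Rouché's theorem** for entire functions on a disk centred at the origin: the quotient `f / g`
maps the circle into the disk `|w - 1| < 1`, where the logarithm is a primitive of its logarithmic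
derivative. -/
lemma rouche {f g : ℂ → ℂ} (hf : Differentiable ℂ f) (hg : Differentiable ℂ g) {R : ℝ}
    (hR : 0 < R) (hfg : ∀ z, ‖z‖ = R → ‖f z - g z‖ < ‖g z‖) {Z W : Finset ℂ}
    (hZ : ∀ a, a ∈ Z ↔ ‖a‖ < R ∧ f a = 0) (hW : ∀ a, a ∈ W ↔ ‖a‖ < R ∧ g a = 0) :
    ∑ a ∈ Z, analyticOrderNatAt f a = ∑ a ∈ W, analyticOrderNatAt g a := by
  have hg0 : ∀ z, ‖z‖ = R → g z ≠ 0 := fun z hz h => by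
    have := hfg z hz
    rw [h, norm_zero] at this
    exact absurd this (norm_nonneg _).not_gt
  have hf0 : ∀ z, ‖z‖ = R → f z ≠ 0 := fun z hz h => by
    have := hfg z hz
    rw [h, zero_sub, norm_neg] at this
    exact lt_irrefl _ this
  have key : (∮ z in C(0, R), (logDeriv f z - logDeriv g z)) = 0 := by
    refine circleIntegral.integral_eq_zero_of_hasDerivWithinAt (f := fun z => log (f z / g z))
      hR.le fun z hz => HasDerivAt.hasDerivWithinAt ?_
    have hzR : ‖z‖ = R := by simpa using hz
    have hslit : f z / g z ∈ slitPlane := by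
      refine ball_one_subset_slitPlane ?_
      rw [mem_ball, dist_eq_norm, div_sub_one (hg0 z hzR), norm_div,
        div_lt_one (norm_pos_iff.2 (hg0 z hzR))]
      exact hfg z hzR
    have h1 := ((hf z).hasDerivAt.div (hg z).hasDerivAt (hg0 z hzR)).clog hslit
    refine h1.congr_deriv ?_
    have := hf0 z hzR
    have := hg0 z hzR
    simp only [logDeriv_apply, Pi.div_apply]
    field_simp
  have hci : ∀ {h : ℂ → ℂ}, Differentiable ℂ h → (∀ z, ‖z‖ = R → h z ≠ 0) →
      CircleIntegrable (logDeriv h) 0 R := fun {h} hh h0 =>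
    ContinuousOn.circleIntegrable hR.le fun z hz =>
      (((hh.analyticAt z).deriv.differentiableAt).div (hh z)
        (h0 z (by simpa using hz))).continuousAt.continuousWithinAt
  rw [circleIntegral.integral_sub (hci hf hf0) (hci hg hg0), circleIntegral_logDeriv_eq hf hR hf0 hZ,
    circleIntegral_logDeriv_eq hg hR hg0 hW, ← mul_sub, mul_eq_zero] at key
  rcases key with h | h
  · exact absurd h (by simp [Real.pi_ne_zero])
  · rw [sub_eq_zero] at h
    exact_mod_cast h

lemma finite_zeros_of_entire {f : ℂ → ℂ} (hf : Differentiable ℂ f) {w : ℂ} (hw : f w ≠ 0)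
    (R : ℝ) : ({a | ‖a‖ < R ∧ f a = 0} : Set ℂ).Finite := by
  have hfa : AnalyticOnNhd ℂ f univ := fun x _ => hf.analyticAt x
  by_contra hinf
  obtain ⟨x, -, hx⟩ := Set.Infinite.exists_accPt_of_subset_isCompact
    (K := closedBall (0 : ℂ) R) hinf (isCompact_closedBall (0 : ℂ) R)
    (fun a ha => by simpa using ha.1.le)
  rw [accPt_iff_frequently_nhdsNE] at hx
  exact hw (hfa.eqOn_zero_of_preconnected_of_frequently_eq_zero isPreconnected_univ (mem_univ x)
    (hx.mono fun _ h => h.2) (mem_univ w))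

lemma exists_fin_map_eq {α : Type*} (M : Multiset α) {k : ℕ} (hk : M.card = k) :
    ∃ e : Fin k → α, Multiset.map e Finset.univ.val = M := by
  subst hk
  refine ⟨fun i => M.toList.get (i.cast (by simp)), ?_⟩
  rw [Fin.univ_val_map]
  conv_rhs => rw [← M.coe_toList]
  congr 1
  refine List.ext_get (by simp) fun n h1 h2 => ?_
  simp

/-- If an entire function has exactly `n + 1` zeros, counted with multiplicity, in the disk of
radius `R n` for all `n ≥ n₀`, then its zeros can be listed so that for `n > n₀` the `n`-th one is
the only one in the annulus between the radii `R (n - 1)` and `R n`. -/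
lemma exists_enumeration {f : ℂ → ℂ} (hf : Differentiable ℂ f) {n₀ : ℕ} {R : ℕ → ℝ}
    (hmono : ∀ n, R n < R (n + 1)) (hlim : Tendsto R atTop atTop)
    (hcount : ∀ n, n₀ ≤ n → (∀ z, ‖z‖ = R n → f z ≠ 0) ∧ ∃ Z : Finset ℂ,
      (∀ a, a ∈ Z ↔ ‖a‖ < R n ∧ f a = 0) ∧ ∑ a ∈ Z, analyticOrderNatAt f a = n + 1) :
    ∃ ev : ℕ → ℂ, (∀ z : ℂ, {n : ℕ | ev n = z}.encard = analyticOrderAt f z) ∧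
      ∀ n, n₀ < n → f (ev n) = 0 ∧ R (n - 1) < ‖ev n‖ ∧ ‖ev n‖ < R n := by
  classical
  have hRmono : StrictMono R := strictMono_nat_of_lt_succ hmono
  choose! hsph Z hZ hsum using hcount
  obtain ⟨w, hw⟩ : ∃ w, f w ≠ 0 := by
    obtain ⟨n, hn, hn'⟩ := ((hlim.eventually_ge_atTop 0).and (eventually_ge_atTop n₀)).exists
    exact ⟨(R n : ℂ), hsph n hn' _ (by simp [abs_of_nonneg hn])⟩
  have htop := analyticOrderAt_ne_top_of_entire hf hw
  have hpos : ∀ a, f a = 0 → 1 ≤ analyticOrderNatAt f a := by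
    intro a ha
    have h1 := (hf.analyticAt a).analyticOrderAt_ne_zero.2 ha
    rw [← Nat.cast_analyticOrderNatAt (htop a)] at h1
    exact Nat.one_le_iff_ne_zero.2 (by exact_mod_cast h1)
  -- One simple zero in each annulus.
  have hann : ∀ n, n₀ < n → ∃ v, analyticOrderNatAt f v = 1 ∧
      ∀ a, (a = v ↔ f a = 0 ∧ R (n - 1) < ‖a‖ ∧ ‖a‖ < R n) := by
    intro n hn
    obtain ⟨m, rfl⟩ : ∃ m, n = m + 1 := ⟨n - 1, by omega⟩
    have hm : n₀ ≤ m := by omega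
    have hsub : Z m ⊆ Z (m + 1) := fun a ha =>
      (hZ (m + 1) (by omega) a).2 ⟨((hZ m hm a).1 ha).1.trans (hmono m), ((hZ m hm a).1 ha).2⟩
    have h1 : ∑ a ∈ Z (m + 1) \ Z m, analyticOrderNatAt f a = 1 := by
      have := Finset.sum_sdiff (f := fun a => analyticOrderNatAt f a) hsub
      rw [hsum m hm, hsum (m + 1) (by omega)] at this
      omega
    have hmem : ∀ a, a ∈ Z (m + 1) \ Z m ↔ f a = 0 ∧ R m < ‖a‖ ∧ ‖a‖ < R (m + 1) := by
      intro a
      rw [Finset.mem_sdiff, hZ (m + 1) (by omega), hZ m hm]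
      constructor
      · rintro ⟨⟨h2, h3⟩, h4⟩
        have h5 : R m ≤ ‖a‖ := not_lt.1 fun h => h4 ⟨h, h3⟩
        exact ⟨h3, h5.lt_of_ne fun h => hsph m hm a h.symm h3, h2⟩
      · rintro ⟨h2, h3, h4⟩
        exact ⟨⟨h4, h2⟩, fun h => absurd h.1 h3.not_gt⟩
    have hcard : (Z (m + 1) \ Z m).card = 1 := by
      refine le_antisymm ?_ ?_
      · calc (Z (m + 1) \ Z m).card = ∑ a ∈ Z (m + 1) \ Z m, 1 := by simp
          _ ≤ ∑ a ∈ Z (m + 1) \ Z m, analyticOrderNatAt f a :=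
            Finset.sum_le_sum fun a ha => hpos a ((hmem a).1 ha).1
          _ = 1 := h1
      · rw [Nat.one_le_iff_ne_zero, Finset.card_ne_zero]
        by_contra h
        rw [Finset.not_nonempty_iff_eq_empty] at h
        simp [h] at h1
    obtain ⟨v, hv⟩ := Finset.card_eq_one.1 hcard
    refine ⟨v, by simpa [hv] using h1, fun a => ?_⟩
    rw [Nat.add_sub_cancel, ← hmem a, hv, Finset.mem_singleton]
  choose! v hv1 hv using hann
  -- The multiset of the zeros in the first disk.
  set M : Multiset ℂ := ∑ a ∈ Z n₀, analyticOrderNatAt f a • {a} with hM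
  have hMcard : M.card = n₀ + 1 := by
    rw [hM, Multiset.card_sum, ← hsum n₀ le_rfl]
    simp
  have hMcount : ∀ a, M.count a = if a ∈ Z n₀ then analyticOrderNatAt f a else 0 := by
    intro a
    rw [hM, Multiset.count_sum']
    simp [Multiset.count_singleton]
  obtain ⟨e, he⟩ := exists_fin_map_eq M hMcard
  have hemem : ∀ i, e i ∈ Z n₀ := by
    intro i
    have : e i ∈ M := he ▸ Multiset.mem_map_of_mem e (Finset.mem_univ i)
    rw [← Multiset.count_pos, hMcount] at this
    by_contra h
    simp [h] at this
  set ev : ℕ → ℂ := fun n => if h : n < n₀ + 1 then e ⟨n, h⟩ else v n with hev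
  have hev1 : ∀ n, n₀ < n → ev n = v n := fun n hn => by
    simp only [hev]
    rw [dif_neg (by omega)]
  have hev0 : ∀ n, n ≤ n₀ → ‖ev n‖ < R n₀ ∧ f (ev n) = 0 := fun n hn => by
    simp only [hev]
    rw [dif_pos (by omega)]
    exact (hZ n₀ le_rfl _).1 (hemem _)
  have hevn : ∀ n, n₀ < n → f (ev n) = 0 ∧ R (n - 1) < ‖ev n‖ ∧ ‖ev n‖ < R n := fun n hn => by
    rw [hev1 n hn]
    exact (hv n hn _).1 rfl
  refine ⟨ev, fun z => ?_, hevn⟩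
  by_cases hz : f z = 0
  swap
  · rw [(hf.analyticAt z).analyticOrderAt_eq_zero.2 hz, encard_eq_zero, eq_empty_iff_forall_notMem]
    rintro n rfl
    rcases le_or_gt n n₀ with h | h
    · exact hz (hev0 n h).2
    · exact hz (hevn n h).1
  rcases lt_trichotomy ‖z‖ (R n₀) with hlt | heq | hgt
  · have hset : {n | ev n = z} = (fun i : Fin (n₀ + 1) => (i : ℕ)) '' {i | e i = z} := by
      ext n
      constructor
      · intro hn
        have hn' : n < n₀ + 1 := by
          by_contra h
          have h1 := (hevn n (by omega)).2.1
          rw [show ev n = z from hn] at h1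
          exact absurd (h1.trans hlt) ((hRmono.monotone (by omega)).not_gt)
        refine ⟨⟨n, hn'⟩, ?_, rfl⟩
        have h1 : ev n = z := hn
        simp only [hev] at h1
        rwa [dif_pos hn'] at h1
      · rintro ⟨i, hi, rfl⟩
        have hi' : e i = z := hi
        simp only [hev, mem_ofPred_eq]
        rw [dif_pos i.2]
        exact hi'
    rw [hset, Function.Injective.encard_image Fin.val_injective,
      ← Nat.cast_analyticOrderNatAt (htop z)]
    have h2 := hMcount z
    rw [if_pos ((hZ n₀ le_rfl z).2 ⟨hlt, hz⟩), ← he, Multiset.count_map] at h2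
    rw [← h2]
    have h3 : {i | e i = z} = ((Finset.univ.filter fun i => z = e i : Finset (Fin (n₀ + 1))) :
        Set (Fin (n₀ + 1))) := by
      ext i; simp [eq_comm]
    rw [h3, encard_coe_eq_coe_finsetCard]
    rfl
  · exact absurd hz (hsph n₀ le_rfl z heq)
  · have hex : ∃ n, ‖z‖ < R n := (hlim.eventually_gt_atTop ‖z‖).exists
    set n := Nat.find hex with hn
    have hn1 : ‖z‖ < R n := Nat.find_spec hex
    have hn0 : n₀ < n := by
      by_contra h
      exact absurd (hgt.trans hn1) (hRmono.monotone (not_lt.1 h)).not_gt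
    have hn2 : R (n - 1) < ‖z‖ := by
      have h1 : ¬ ‖z‖ < R (n - 1) := Nat.find_min hex (by omega)
      exact (not_lt.1 h1).lt_of_ne fun h => hsph (n - 1) (by omega) z h.symm hz
    have hzv : z = v n := (hv n hn0 z).2 ⟨hz, hn2, hn1⟩
    have hset : {k | ev k = z} = {n} := by
      ext k
      simp only [mem_ofPred_eq, mem_singleton_iff]
      constructor
      · rintro rfl
        rcases le_or_gt k n₀ with h | h
        · exact absurd ((hev0 k h).1.trans hgt) (lt_irrefl _)
        · obtain ⟨-, h1, h2⟩ := hevn k h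
          have h3 := hRmono.lt_iff_lt.1 (h1.trans hn1)
          have h4 := hRmono.lt_iff_lt.1 (hn2.trans h2)
          omega
      · rintro rfl
        rw [hev1 _ hn0, hzv]
    rw [hset, encard_singleton, ← Nat.cast_analyticOrderNatAt (htop z), hzv, hv1 n hn0]
    rfl

/-! ### The functions `cosRoot` and `sinRoot` -/

lemma cpow_half_sq (z : ℂ) : (z ^ (1 / 2 : ℂ)) ^ 2 = z := by
  rw [one_div]
  exact_mod_cast cpow_nat_inv_pow z two_ne_zero

lemma cosRoot_sq (ρ : ℂ) (x : ℝ) : cosRoot (ρ ^ 2) x = cos (ρ * x) := by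
  rcases sq_eq_sq_iff_eq_or_eq_neg.1 (cpow_half_sq (ρ ^ 2)) with h | h
  · rw [cosRoot, h]
  · rw [cosRoot, h, neg_mul, cos_neg]

lemma sinRoot_sq {ρ : ℂ} (hρ : ρ ≠ 0) (x : ℝ) : sinRoot (ρ ^ 2) x = sin (ρ * x) / ρ := by
  rw [sinRoot, if_neg (pow_ne_zero 2 hρ)]
  rcases sq_eq_sq_iff_eq_or_eq_neg.1 (cpow_half_sq (ρ ^ 2)) with h | h
  · rw [h]
  · rw [h, neg_mul, sin_neg, neg_div_neg_eq]

lemma sinRoot_zero_left (x : ℝ) : sinRoot 0 x = x := by simp [sinRoot]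

lemma exists_sq_eq (z : ℂ) : ∃ ρ : ℂ, z = ρ ^ 2 := ⟨_, (cpow_half_sq z).symm⟩

@[simp] lemma cosRoot_zero (z : ℂ) : cosRoot z 0 = 1 := by simp [cosRoot]

@[simp] lemma sinRoot_zero (z : ℂ) : sinRoot z 0 = 0 := by simp [sinRoot]

@[simp] lemma cosRoot_neg (z : ℂ) (x : ℝ) : cosRoot z (-x) = cosRoot z x := by simp [cosRoot]

@[simp] lemma sinRoot_neg (z : ℂ) (x : ℝ) : sinRoot z (-x) = -sinRoot z x := by
  unfold sinRoot
  split_ifs <;> simp [neg_div]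

lemma hasDerivAt_cosRoot (z : ℂ) (x : ℝ) :
    HasDerivAt (cosRoot z) (-(z * sinRoot z x)) x := by
  obtain ⟨ρ, rfl⟩ := exists_sq_eq z
  have h0 : HasDerivAt (fun w : ℂ => cos (ρ * w)) (-sin (ρ * x) * (ρ * 1)) (x : ℂ) :=
    ((hasDerivAt_id (x : ℂ)).const_mul ρ).ccos
  have h1 := h0.comp_ofReal
  rw [show cosRoot (ρ ^ 2) = fun y : ℝ => cos (ρ * y) from funext (cosRoot_sq ρ)]
  refine h1.congr_deriv ?_
  rcases eq_or_ne ρ 0 with rfl | hρ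
  · simp
  · rw [sinRoot_sq hρ]
    field_simp

lemma hasDerivAt_sinRoot (z : ℂ) (x : ℝ) : HasDerivAt (sinRoot z) (cosRoot z x) x := by
  obtain ⟨ρ, rfl⟩ := exists_sq_eq z
  rcases eq_or_ne ρ 0 with rfl | hρ
  · rw [cosRoot_sq, zero_pow two_ne_zero, show sinRoot 0 = fun y : ℝ => (y : ℂ) from
      funext sinRoot_zero_left]
    simpa using (hasDerivAt_id (x : ℂ)).comp_ofReal
  · have h0 : HasDerivAt (fun w : ℂ => sin (ρ * w) / ρ) (cos (ρ * x) * (ρ * 1) / ρ) (x : ℂ) :=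
      ((hasDerivAt_id (x : ℂ)).const_mul ρ).csin.div_const ρ
    have h1 := h0.comp_ofReal
    rw [show sinRoot (ρ ^ 2) = fun y : ℝ => sin (ρ * y) / ρ from funext (sinRoot_sq hρ), cosRoot_sq]
    refine h1.congr_deriv ?_
    field_simp

lemma continuous_cosRoot (z : ℂ) : Continuous (cosRoot z) :=
  continuous_iff_continuousAt.2 fun x => (hasDerivAt_cosRoot z x).continuousAt

lemma continuous_sinRoot (z : ℂ) : Continuous (sinRoot z) :=
  continuous_iff_continuousAt.2 fun x => (hasDerivAt_sinRoot z x).continuousAt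

lemma norm_cos_le_exp_abs_im (w : ℂ) : ‖cos w‖ ≤ Real.exp |w.im| := by
  have h1 : ‖exp (w * I)‖ ≤ Real.exp |w.im| := by
    rw [norm_exp]
    refine Real.exp_le_exp.2 ?_
    simpa using neg_le_abs w.im
  have h2 : ‖exp (-w * I)‖ ≤ Real.exp |w.im| := by
    rw [norm_exp]
    refine Real.exp_le_exp.2 ?_
    simpa using le_abs_self w.im
  rw [cos, norm_div, Complex.norm_ofNat]
  have := norm_add_le (exp (w * I)) (exp (-w * I))
  linarith

lemma norm_sin_le_exp_abs_im (w : ℂ) : ‖sin w‖ ≤ Real.exp |w.im| := by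
  have h := norm_cos_le_exp_abs_im (w - Real.pi / 2)
  have h1 : (w - Real.pi / 2).im = w.im := by
    rw [sub_im, show (Real.pi / 2 : ℂ) = ((Real.pi / 2 : ℝ) : ℂ) by push_cast; rfl, ofReal_im,
      sub_zero]
  rwa [cos_sub_pi_div_two, h1] at h

/-- A function that becomes entire after the substitution `z = ρ²` is entire: away from the
origin a branch of the root is holomorphic, and the origin is a removable singularity. -/
lemma differentiable_of_comp_sq {f : ℂ → ℂ} (h : Differentiable ℂ fun ρ : ℂ => f (ρ ^ 2)) :
    Differentiable ℂ f := by
  have hroot : f = fun w => (fun ρ : ℂ => f (ρ ^ 2)) (w ^ (1 / 2 : ℂ)) := by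
    funext w
    simp only [cpow_half_sq]
  have hne : ∀ z : ℂ, z ≠ 0 → DifferentiableAt ℂ f z := by
    intro z hz
    rcases mem_slitPlane_or_neg_mem_slitPlane hz with hz' | hz'
    · rw [hroot]
      exact (h _).comp z (differentiableAt_id.cpow_const hz')
    · have hroot' : f = fun w => (fun ρ : ℂ => f (ρ ^ 2)) (I * (-w) ^ (1 / 2 : ℂ)) := by
        funext w
        simp only [mul_pow, cpow_half_sq, I_sq]
        ring_nf
      rw [hroot']
      refine (h _).comp z (DifferentiableAt.const_mul ?_ I)
      exact (differentiableAt_id.neg).cpow_const hz'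
  have hcont : ContinuousAt f 0 := by
    rw [hroot]
    exact ContinuousAt.comp (f := fun w : ℂ => w ^ (1 / 2 : ℂ)) (g := fun ρ : ℂ => f (ρ ^ 2))
      h.continuous.continuousAt (continuousAt_cpow_const_of_re_pos (by simp) (by norm_num))
  rw [← differentiableOn_univ]
  refine (differentiableOn_compl_singleton_and_continuousAt_iff (c := 0) univ_mem).1 ⟨?_, hcont⟩
  exact fun z hz => (hne z (by simpa using hz)).differentiableWithinAt

lemma differentiable_cosRoot (x : ℝ) : Differentiable ℂ fun z => cosRoot z x := by
  refine differentiable_of_comp_sq ?_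
  simp only [cosRoot_sq]
  fun_prop

/-- For integrable `q` and continuous `φ`, the integral of `sinRoot z (φ t) q(t)` is entire in
`z`. As a function of `ρ` with `ρ² = z` it is the difference quotient at the origin of the entire
function `∫ sin (ρ φ(t)) q(t) dt`. -/
lemma differentiable_integral_sinRoot {φ : ℝ → ℝ} (hφ : Continuous φ) {q : ℝ → ℂ} {α β : ℝ}
    (hq : IntervalIntegrable q volume α β) :
    Differentiable ℂ fun z => ∫ t in α..β, sinRoot z (φ t) * q t := by
  set h : ℂ → ℂ := fun ρ => ∫ t in α..β, sin (ρ * φ t) * q t with hh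
  have hder : ∀ ρ₀, HasDerivAt h (∫ t in α..β, cos (ρ₀ * φ t) * φ t * q t) ρ₀ := by
    intro ρ₀
    refine (intervalIntegral.hasDerivAt_integral_of_dominated_loc_of_deriv_le
      (F := fun ρ t => sin (ρ * φ t) * q t) (F' := fun ρ t => cos (ρ * φ t) * φ t * q t)
      (s := ball ρ₀ 1)
      (bound := fun t => Real.exp ((‖ρ₀‖ + 1) * |φ t|) * |φ t| * ‖q t‖)
      (ball_mem_nhds ρ₀ one_pos) ?_ ?_ ?_ ?_ ?_ ?_).2
    · exact Eventually.of_forall fun ρ =>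
        ((hq.continuousOn_mul (g := fun t => sin (ρ * φ t))
          (by fun_prop)).aestronglyMeasurable_restrict_uIoc)
    · exact hq.continuousOn_mul (g := fun t => sin (ρ₀ * φ t)) (by fun_prop)
    · exact ((hq.continuousOn_mul (g := fun t => cos (ρ₀ * φ t) * φ t)
          (by fun_prop)).aestronglyMeasurable_restrict_uIoc)
    · refine Eventually.of_forall fun t _ ρ hρ => ?_
      rw [norm_mul, norm_mul, norm_real, Real.norm_eq_abs]
      gcongr
      refine (norm_cos_le_exp_abs_im _).trans (Real.exp_le_exp.2 ?_)
      refine (abs_im_le_norm _).trans ?_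
      rw [norm_mul, norm_real, Real.norm_eq_abs]
      gcongr
      have h1 : ‖ρ - ρ₀‖ < 1 := by simpa [dist_eq_norm] using hρ
      have h2 := norm_add_le (ρ - ρ₀) ρ₀
      rw [sub_add_cancel] at h2
      linarith
    · exact hq.norm.continuousOn_mul (by fun_prop)
    · refine Eventually.of_forall fun t _ ρ _ => ?_
      have h1 := (((hasDerivAt_id ρ).mul_const (φ t : ℂ)).csin).mul_const (q t)
      simpa using h1
  have hd : Differentiable ℂ h := fun ρ => (hder ρ).differentiableAt
  refine differentiable_of_comp_sq ?_
  have heq : (fun ρ : ℂ => ∫ t in α..β, sinRoot (ρ ^ 2) (φ t) * q t) = dslope h 0 := by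
    funext ρ
    rcases eq_or_ne ρ 0 with rfl | hρ
    · rw [dslope_same, (hder 0).deriv]
      simp [sinRoot_zero_left]
    · rw [dslope_of_ne _ hρ, slope_def_field, hh]
      simp only [zero_mul, sin_zero, intervalIntegral.integral_zero, sub_zero]
      rw [← intervalIntegral.integral_div]
      refine intervalIntegral.integral_congr fun t _ => ?_
      rw [sinRoot_sq hρ]
      ring
  rw [heq]
  exact differentiable_dslope hd 0

lemma differentiable_sinRoot (x : ℝ) : Differentiable ℂ fun z => sinRoot z x := by
  have h := differentiable_integral_sinRoot (φ := fun _ => x) continuous_const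
    (q := fun _ => 1) (α := 0) (β := 1) (by simp)
  simpa using h

/-! ### Functions of class `W¹₂` -/

lemma MemW12.continuousOn {q : ℝ → ℂ} {α β : ℝ} (hαβ : α ≤ β) (hq : MemW12 q α β) :
    ContinuousOn q (Icc α β) := by
  obtain ⟨g, hg, hqg⟩ := hq
  have hgi : IntegrableOn g (Icc α β) := by
    rw [integrableOn_Icc_iff_integrableOn_Ioc]
    exact hg.integrable one_le_two
  have h1 : ContinuousOn (fun x => q α + ∫ t in α..x, g t) (Icc α β) :=
    continuousOn_const.add (by
      have := intervalIntegral.continuousOn_primitive_interval (a := α) (b := β) (μ := volume)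
        (f := g) (by rwa [uIcc_of_le hαβ])
      rwa [uIcc_of_le hαβ] at this)
  exact h1.congr hqg

/-! ### The characteristic function is entire -/

lemma charFun_eq {γ d : ℝ} (l : ℝ) (hγ : 0 ≤ γ) (hd : 0 < d) (hl : 0 ≤ l) (q : ℝ → ℂ) (z : ℂ) :
    charFun γ d l q z =
      sinRoot z (-γ) * (cosRoot z l + d * (q γ - z) * sinRoot z l
        + ∫ t in (γ + d)..(γ + d + l), sinRoot z (γ + d + l - t) * q t)
      - (cosRoot z (-γ) + ∫ t in γ..0, sinRoot z (0 - t) * q t) *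
        (d * cosRoot z l + (1 - d ^ 2 * z) * sinRoot z l) := by
  have h1 : ¬ γ + d + l ≤ γ := by linarith
  rw [charFun, Matrix.det_fin_two_of, solS, solC, solS, solC, if_pos hγ, if_pos hγ, if_neg h1,
    if_neg h1, zero_sub, add_sub_cancel_left]

lemma differentiable_charFun {γ d l : ℝ} (hγ : 0 ≤ γ) (hd : 0 < d) (hl : 0 ≤ l) {q : ℝ → ℂ}
    (hq₁ : ContinuousOn q (Icc 0 γ)) (hq₂ : ContinuousOn q (Icc (γ + d) (γ + d + l))) :
    Differentiable ℂ (charFun γ d l q) := by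
  rw [show charFun γ d l q = _ from funext (charFun_eq l hγ hd hl q)]
  have h1 := differentiable_sinRoot (-γ)
  have h2 := differentiable_sinRoot l
  have h3 := differentiable_cosRoot (-γ)
  have h4 := differentiable_cosRoot l
  have h5 := differentiable_integral_sinRoot (φ := fun t => γ + d + l - t) (by fun_prop) (q := q)
    (α := γ + d) (β := γ + d + l) (hq₂.intervalIntegrable_of_Icc (by linarith))
  have h6 := differentiable_integral_sinRoot (φ := fun t => 0 - t) (by fun_prop) (q := q)
    (α := γ) (β := 0) (hq₁.intervalIntegrable_of_Icc hγ).symm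
  fun_prop

/-! ### Delta derivatives on two segments -/

lemma sigma_twoSegments_left {γ d l t : ℝ} (ht : t ∈ Ico 0 γ) :
    sigma (twoSegments γ d l) t = t := by
  have hmem : ∀ s ∈ Ioc t γ, s ∈ twoSegments γ d l ∩ Ioi t := fun s hs =>
    ⟨Or.inl ⟨ht.1.trans hs.1.le, hs.2⟩, hs.1⟩
  rw [sigma, if_pos ⟨γ, hmem γ ⟨ht.2, le_rfl⟩⟩]
  refine csInf_eq_of_forall_ge_of_forall_gt_exists_lt ⟨γ, hmem γ ⟨ht.2, le_rfl⟩⟩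
    (fun s hs => (show t < s from hs.2).le) fun w hw => ?_
  obtain ⟨s, hs1, hs2⟩ := exists_between (lt_min hw ht.2)
  exact ⟨s, hmem s ⟨hs1, (hs2.trans_le (min_le_right _ _)).le⟩, hs2.trans_le (min_le_left _ _)⟩

lemma sigma_twoSegments_gap {γ d l : ℝ} (hd : 0 < d) (hl : 0 ≤ l) :
    sigma (twoSegments γ d l) γ = γ + d := by
  have hmem : γ + d ∈ twoSegments γ d l ∩ Ioi γ :=
    ⟨Or.inr ⟨le_rfl, by linarith⟩, by simpa using hd⟩
  rw [sigma, if_pos ⟨_, hmem⟩]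
  refine IsLeast.csInf_eq ⟨hmem, ?_⟩
  rintro s ⟨hs | hs, hs'⟩
  · exact absurd hs.2 (not_le.2 hs')
  · exact hs.1

lemma sigma_twoSegments_right {γ d l t : ℝ} (hd : 0 < d) (ht : t ∈ Icc (γ + d) (γ + d + l)) :
    sigma (twoSegments γ d l) t = t := by
  rcases ht.2.lt_or_eq with h | h
  · have hmem : ∀ s ∈ Ioc t (γ + d + l), s ∈ twoSegments γ d l ∩ Ioi t := fun s hs =>
      ⟨Or.inr ⟨ht.1.trans hs.1.le, hs.2⟩, hs.1⟩
    rw [sigma, if_pos ⟨_, hmem _ ⟨h, le_rfl⟩⟩]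
    refine csInf_eq_of_forall_ge_of_forall_gt_exists_lt ⟨_, hmem _ ⟨h, le_rfl⟩⟩
      (fun s hs => (show t < s from hs.2).le) fun w hw => ?_
    obtain ⟨s, hs1, hs2⟩ := exists_between (lt_min hw h)
    exact ⟨s, hmem s ⟨hs1, (hs2.trans_le (min_le_right _ _)).le⟩, hs2.trans_le (min_le_left _ _)⟩
  · rw [sigma, if_neg]
    rintro ⟨s, hs | hs, hs'⟩
    · have h1 : t < s := hs'
      linarith [hs.2, ht.1]
    · have h1 : t < s := hs'
      linarith [hs.2]

/-- At a right-dense point a `Δ`-derivative is a derivative within `T`. -/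
lemma hasDeltaDerivAt_iff_of_sigma_eq {T : Set ℝ} {f : ℝ → ℂ} {m : ℂ} {t : ℝ}
    (h : sigma T t = t) : HasDeltaDerivAt T f m t ↔ HasDerivWithinAt f m T t := by
  rw [hasDerivWithinAt_iff_isLittleO, Asymptotics.isLittleO_iff, HasDeltaDerivAt, h]
  have hn : ∀ s, ‖f t - f s - m * ((t - s : ℝ) : ℂ)‖ = ‖f s - f t - (s - t) • m‖ := by
    intro s
    rw [← norm_neg]
    congr 1
    rw [real_smul]
    push_cast
    ring
  refine forall₂_congr fun ε _ => ?_
  rw [eventually_nhdsWithin_iff, Metric.eventually_nhds_iff]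
  refine exists_congr fun δ => and_congr_right fun _ => ?_
  simp only [hn, Real.dist_eq, Real.norm_eq_abs, abs_sub_comm t]
  exact forall_congr' fun s => ⟨fun h1 h2 h3 => h1 h3 h2, fun h1 h2 h3 => h1 h3 h2⟩

/-- At the right-isolated point `γ` a `Δ`-derivative is the slope across the gap, together with
continuity of the function. -/
lemma hasDeltaDerivAt_gap_iff {γ d l : ℝ} (hγ : 0 ≤ γ) (hd : 0 < d) (hl : 0 ≤ l) {f : ℝ → ℂ}
    {m : ℂ} : HasDeltaDerivAt (twoSegments γ d l) f m γ ↔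
      f (γ + d) - f γ = m * d ∧ ContinuousWithinAt f (twoSegments γ d l) γ := by
  have hγT : γ ∈ twoSegments γ d l := Or.inl ⟨hγ, le_rfl⟩
  have hlin : Continuous fun s : ℝ => m * ((γ + d - s : ℝ) : ℂ) := by fun_prop
  have hlin0 : m * ((γ + d - γ : ℝ) : ℂ) = m * d := by simp
  rw [HasDeltaDerivAt, sigma_twoSegments_gap hd hl]
  constructor
  · intro h
    have heq : f (γ + d) - f γ = m * d := by
      have h1 : ‖f (γ + d) - f γ - m * d‖ ≤ 0 := by
        refine le_of_forall_pos_le_add fun ε hε => ?_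
        obtain ⟨δ, hδ, hs⟩ := h (ε / d) (by positivity)
        have h2 := hs γ hγT (by simpa using hδ)
        rw [hlin0, add_sub_cancel_left, abs_of_pos hd, div_mul_cancel₀ _ hd.ne'] at h2
        simpa using h2
      exact sub_eq_zero.1 (norm_le_zero_iff.1 h1)
    refine ⟨heq, ?_⟩
    have h0 : Tendsto (fun s => f (γ + d) - f s - m * ((γ + d - s : ℝ) : ℂ))
        (𝓝[twoSegments γ d l] γ) (𝓝 0) := by
      rw [Metric.tendsto_nhds]
      intro ε hε
      obtain ⟨δ, hδ, hs⟩ := h (ε / (2 * (d + 1))) (by positivity)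
      rw [eventually_nhdsWithin_iff, Metric.eventually_nhds_iff]
      refine ⟨min δ 1, lt_min hδ one_pos, fun s hs1 hsT => ?_⟩
      rw [Real.dist_eq] at hs1
      rw [dist_zero_right]
      refine (hs s hsT (hs1.trans_le (min_le_left _ _))).trans_lt ?_
      have h2 : |γ + d - s| ≤ d + 1 := by
        have h3 := (abs_lt.1 (hs1.trans_le (min_le_right _ _)))
        rw [abs_le]
        constructor <;> linarith
      calc ε / (2 * (d + 1)) * |γ + d - s| ≤ ε / (2 * (d + 1)) * (d + 1) := by gcongr
        _ = ε / 2 := by field_simp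
        _ < ε := by linarith
    have h1 : Tendsto (fun s => f (γ + d) - m * ((γ + d - s : ℝ) : ℂ)
        - (f (γ + d) - f s - m * ((γ + d - s : ℝ) : ℂ)))
        (𝓝[twoSegments γ d l] γ) (𝓝 (f (γ + d) - m * ((γ + d - γ : ℝ) : ℂ) - 0)) :=
      (tendsto_const_nhds.sub (hlin.continuousAt.continuousWithinAt)).sub h0
    rw [hlin0, ← heq] at h1
    rw [ContinuousWithinAt]
    convert h1 using 2
    · ring
    · ring
  · rintro ⟨heq, hc⟩ ε hε
    have h1 : Tendsto (fun s => f (γ + d) - f s - m * ((γ + d - s : ℝ) : ℂ))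
        (𝓝[twoSegments γ d l] γ) (𝓝 0) := by
      have h2 : Tendsto (fun s => f (γ + d) - f s - m * ((γ + d - s : ℝ) : ℂ))
        (𝓝[twoSegments γ d l] γ) (𝓝 (f (γ + d) - f γ - m * ((γ + d - γ : ℝ) : ℂ))) :=
        (tendsto_const_nhds.sub hc).sub (hlin.continuousAt.continuousWithinAt)
      rwa [hlin0, heq, sub_self] at h2
    rw [Metric.tendsto_nhds] at h1
    have h3 := h1 (ε * (d / 2)) (by positivity)
    rw [eventually_nhdsWithin_iff, Metric.eventually_nhds_iff] at h3
    obtain ⟨δ, hδ, hs⟩ := h3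
    refine ⟨min δ (d / 2), lt_min hδ (by positivity), fun s hsT hs1 => ?_⟩
    have h4 := hs (y := s) (by rw [Real.dist_eq]; exact hs1.trans_le (min_le_left _ _)) hsT
    rw [dist_zero_right] at h4
    refine h4.le.trans ?_
    gcongr
    have h5 := abs_lt.1 (hs1.trans_le (min_le_right _ _))
    refine le_trans ?_ (le_abs_self _)
    linarith

/-! ### The equation on one segment -/

lemma sinRoot_sub (z : ℂ) (x t : ℝ) :
    sinRoot z (x - t) = sinRoot z x * cosRoot z t - cosRoot z x * sinRoot z t := by
  obtain ⟨ρ, rfl⟩ := exists_sq_eq z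
  rcases eq_or_ne ρ 0 with rfl | hρ
  · simp [sinRoot_zero_left, cosRoot]
  · simp only [sinRoot_sq hρ, cosRoot_sq]
    push_cast
    rw [mul_sub, sin_sub]
    field_simp

lemma cosRoot_sub (z : ℂ) (x t : ℝ) :
    cosRoot z (x - t) = cosRoot z x * cosRoot z t + z * sinRoot z x * sinRoot z t := by
  obtain ⟨ρ, rfl⟩ := exists_sq_eq z
  rcases eq_or_ne ρ 0 with rfl | hρ
  · simp [cosRoot]
  · simp only [sinRoot_sq hρ, cosRoot_sq]
    push_cast
    rw [mul_sub, cos_sub]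
    field_simp

/-- The solution of `y'' + z y = Q` with `y(t₀) = y₀` and `y'(t₀) = y₁`. -/
noncomputable def segSol (z : ℂ) (t₀ : ℝ) (y₀ y₁ : ℂ) (Q : ℝ → ℂ) (x : ℝ) : ℂ :=
  y₀ * cosRoot z (x - t₀) + y₁ * sinRoot z (x - t₀) + ∫ t in t₀..x, sinRoot z (x - t) * Q t

/-- The derivative of `segSol`. -/
noncomputable def segSolDeriv (z : ℂ) (t₀ : ℝ) (y₀ y₁ : ℂ) (Q : ℝ → ℂ) (x : ℝ) : ℂ :=
  -(z * y₀ * sinRoot z (x - t₀)) + y₁ * cosRoot z (x - t₀) + ∫ t in t₀..x, cosRoot z (x - t) * Q t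

lemma integral_sinRoot_sub (z : ℂ) {Q : ℝ → ℂ} (hQ : Continuous Q) (t₀ x : ℝ) :
    ∫ t in t₀..x, sinRoot z (x - t) * Q t = sinRoot z x * (∫ t in t₀..x, cosRoot z t * Q t)
      - cosRoot z x * ∫ t in t₀..x, sinRoot z t * Q t := by
  have h1 := continuous_cosRoot z
  have h2 := continuous_sinRoot z
  rw [← intervalIntegral.integral_const_mul, ← intervalIntegral.integral_const_mul,
    ← intervalIntegral.integral_sub]
  · refine intervalIntegral.integral_congr fun t _ => ?_
    simp only [sinRoot_sub]
    ring
  · exact Continuous.intervalIntegrable (by fun_prop) _ _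
  · exact Continuous.intervalIntegrable (by fun_prop) _ _

lemma integral_cosRoot_sub (z : ℂ) {Q : ℝ → ℂ} (hQ : Continuous Q) (t₀ x : ℝ) :
    ∫ t in t₀..x, cosRoot z (x - t) * Q t = cosRoot z x * (∫ t in t₀..x, cosRoot z t * Q t)
      + z * sinRoot z x * ∫ t in t₀..x, sinRoot z t * Q t := by
  have h1 := continuous_cosRoot z
  have h2 := continuous_sinRoot z
  rw [← intervalIntegral.integral_const_mul, ← intervalIntegral.integral_const_mul,
    ← intervalIntegral.integral_add]
  · refine intervalIntegral.integral_congr fun t _ => ?_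
    simp only [cosRoot_sub]
    ring
  · exact Continuous.intervalIntegrable (by fun_prop) _ _
  · exact Continuous.intervalIntegrable (by fun_prop) _ _

lemma hasDerivAt_segSol (z : ℂ) (t₀ : ℝ) (y₀ y₁ : ℂ) {Q : ℝ → ℂ} (hQ : Continuous Q) (x : ℝ) :
    HasDerivAt (segSol z t₀ y₀ y₁ Q) (segSolDeriv z t₀ y₀ y₁ Q x) x := by
  have hc := (hasDerivAt_cosRoot z (x - t₀)).comp_sub_const x t₀
  have hs := (hasDerivAt_sinRoot z (x - t₀)).comp_sub_const x t₀
  have hU : HasDerivAt (fun x => ∫ t in t₀..x, cosRoot z t * Q t) (cosRoot z x * Q x) x :=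
    ((continuous_cosRoot z).mul hQ).integral_hasStrictDerivAt t₀ x |>.hasDerivAt
  have hV : HasDerivAt (fun x => ∫ t in t₀..x, sinRoot z t * Q t) (sinRoot z x * Q x) x :=
    ((continuous_sinRoot z).mul hQ).integral_hasStrictDerivAt t₀ x |>.hasDerivAt
  have hK := ((hasDerivAt_sinRoot z x).mul hU).sub ((hasDerivAt_cosRoot z x).mul hV)
  have hfun : segSol z t₀ y₀ y₁ Q = fun x => y₀ * cosRoot z (x - t₀) + y₁ * sinRoot z (x - t₀) +
      (sinRoot z x * (∫ t in t₀..x, cosRoot z t * Q t)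
        - cosRoot z x * ∫ t in t₀..x, sinRoot z t * Q t) := by
    funext x
    rw [segSol, integral_sinRoot_sub z hQ]
  rw [hfun]
  refine (((hc.const_mul y₀).add (hs.const_mul y₁)).add hK).congr_deriv ?_
  rw [segSolDeriv, integral_cosRoot_sub z hQ]
  ring

lemma hasDerivAt_segSolDeriv (z : ℂ) (t₀ : ℝ) (y₀ y₁ : ℂ) {Q : ℝ → ℂ} (hQ : Continuous Q)
    (x : ℝ) :
    HasDerivAt (segSolDeriv z t₀ y₀ y₁ Q) (Q x - z * segSol z t₀ y₀ y₁ Q x) x := by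
  have hc := (hasDerivAt_cosRoot z (x - t₀)).comp_sub_const x t₀
  have hs := (hasDerivAt_sinRoot z (x - t₀)).comp_sub_const x t₀
  have hU : HasDerivAt (fun x => ∫ t in t₀..x, cosRoot z t * Q t) (cosRoot z x * Q x) x :=
    ((continuous_cosRoot z).mul hQ).integral_hasStrictDerivAt t₀ x |>.hasDerivAt
  have hV : HasDerivAt (fun x => ∫ t in t₀..x, sinRoot z t * Q t) (sinRoot z x * Q x) x :=
    ((continuous_sinRoot z).mul hQ).integral_hasStrictDerivAt t₀ x |>.hasDerivAt
  have hK := ((hasDerivAt_cosRoot z x).mul hU).add (((hasDerivAt_sinRoot z x).const_mul z).mul hV)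
  have hfun : segSolDeriv z t₀ y₀ y₁ Q = fun x => -(z * y₀ * sinRoot z (x - t₀))
      + y₁ * cosRoot z (x - t₀) + (cosRoot z x * (∫ t in t₀..x, cosRoot z t * Q t)
        + z * sinRoot z x * ∫ t in t₀..x, sinRoot z t * Q t) := by
    funext x
    rw [segSolDeriv, integral_cosRoot_sub z hQ]
  have h1 : cosRoot z x * cosRoot z x + z * sinRoot z x * sinRoot z x = 1 := by
    rw [← cosRoot_sub, sub_self, cosRoot_zero]
  rw [hfun]
  refine (((hs.const_mul (z * y₀)).neg.add (hc.const_mul y₁)).add hK).congr_deriv ?_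
  rw [segSol, integral_sinRoot_sub z hQ]
  linear_combination (Q x) * h1

lemma contDiff_segSol (z : ℂ) (t₀ : ℝ) (y₀ y₁ : ℂ) {Q : ℝ → ℂ} (hQ : Continuous Q) :
    ContDiff ℝ 2 (segSol z t₀ y₀ y₁ Q) := by
  have h1 := hasDerivAt_segSol z t₀ y₀ y₁ hQ
  have h2 := hasDerivAt_segSolDeriv z t₀ y₀ y₁ hQ
  have hd : Differentiable ℝ (segSol z t₀ y₀ y₁ Q) := fun x => (h1 x).differentiableAt
  rw [show (2 : WithTop ℕ∞) = 1 + 1 by norm_num, contDiff_succ_iff_deriv,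
    show deriv (segSol z t₀ y₀ y₁ Q) = segSolDeriv z t₀ y₀ y₁ Q from funext fun x => (h1 x).deriv,
    contDiff_one_iff_deriv, show deriv (segSolDeriv z t₀ y₀ y₁ Q) = _ from
      funext fun x => (h2 x).deriv]
  refine ⟨hd, by simp, fun x => (h2 x).differentiableAt, ?_⟩
  exact hQ.sub (continuous_const.mul hd.continuous)

/-- Variation of constants. For fixed `x`, the function
`t ↦ y(t) cos (ρ (x - t)) + y'(t) sin (ρ (x - t)) / ρ` has derivative `Q(t) sin (ρ (x - t)) / ρ`. -/
lemma eq_segSol {z : ℂ} {t₀ x : ℝ} {y u Q : ℝ → ℂ} (hy : ContinuousOn y (uIcc t₀ x))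
    (hu : ContinuousOn u (uIcc t₀ x)) (hQ : ContinuousOn Q (uIcc t₀ x))
    (hyd : ∀ t ∈ Ioo (min t₀ x) (max t₀ x), HasDerivAt y (u t) t)
    (hud : ∀ t ∈ Ioo (min t₀ x) (max t₀ x), HasDerivAt u (Q t - z * y t) t) :
    y x = segSol z t₀ (y t₀) (u t₀) Q x := by
  have h1 := continuous_cosRoot z
  have h2 := continuous_sinRoot z
  have h3 : Continuous fun t => cosRoot z (x - t) := by fun_prop
  have h4 : Continuous fun t => sinRoot z (x - t) := by fun_prop
  have key := intervalIntegral.integral_eq_sub_of_hasDeriv_right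
    (f := fun t => y t * cosRoot z (x - t) + u t * sinRoot z (x - t))
    (f' := fun t => sinRoot z (x - t) * Q t) (a := t₀) (b := x)
    ((hy.mul h3.continuousOn).add (hu.mul h4.continuousOn)) (fun t ht => by
      have hc := (hasDerivAt_cosRoot z (x - t)).comp_const_sub x t
      have hs := (hasDerivAt_sinRoot z (x - t)).comp_const_sub x t
      have h5 := ((hyd t ht).mul hc).add ((hud t ht).mul hs)
      refine (h5.congr_deriv ?_).hasDerivWithinAt
      ring) ((h4.continuousOn.mul hQ).intervalIntegrable)
  simp only [sub_self, cosRoot_zero, sinRoot_zero, mul_one, mul_zero, add_zero] at key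
  rw [segSol, key]
  ring

/-! ### Eigenvalues are the zeros of the characteristic function -/

lemma twoSegments_mem_nhds_left {γ d l t : ℝ} (ht : t ∈ Ioo 0 γ) : twoSegments γ d l ∈ 𝓝 t :=
  mem_of_superset (Icc_mem_nhds ht.1 ht.2) subset_union_left

lemma twoSegments_mem_nhds_right {γ d l t : ℝ} (ht : t ∈ Ioo (γ + d) (γ + d + l)) :
    twoSegments γ d l ∈ 𝓝 t :=
  mem_of_superset (Icc_mem_nhds ht.1 ht.2) subset_union_right

/-- A function that is `Δ`-differentiable on `T` is continuous on `T`. -/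
lemma continuousOn_of_hasDeltaDerivAt {γ d l : ℝ} (hγ : 0 ≤ γ) (hd : 0 < d) (hl : 0 ≤ l)
    {f m : ℝ → ℂ}
    (h : ∀ t ∈ twoSegments γ d l, HasDeltaDerivAt (twoSegments γ d l) f (m t) t) :
    ContinuousOn f (twoSegments γ d l) := by
  intro t ht
  have h1 := h t ht
  rcases ht with ht | ht
  · rcases ht.2.lt_or_eq with h2 | rfl
    · exact ((hasDeltaDerivAt_iff_of_sigma_eq
        (sigma_twoSegments_left ⟨ht.1, h2⟩)).1 h1).continuousWithinAt
    · exact ((hasDeltaDerivAt_gap_iff hγ hd hl).1 h1).2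
  · exact ((hasDeltaDerivAt_iff_of_sigma_eq
      (sigma_twoSegments_right hd ht)).1 h1).continuousWithinAt

/-- Every solution is a linear combination of `S` and `C`. -/
lemma IsSolution.exists_eq {γ d l : ℝ} (hγ : 0 ≤ γ) (hd : 0 < d) (hl : 0 ≤ l) {q : ℝ → ℂ}
    (hq₁ : ContinuousOn q (Icc 0 γ)) (hq₂ : ContinuousOn q (Icc (γ + d) (γ + d + l)))
    {z : ℂ} {y : ℝ → ℂ} (h : IsSolution γ d l q z y) :
    ∃ A B : ℂ, ∀ t ∈ twoSegments γ d l, y t = A * solS γ d z t + B * solC γ d q z t := by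
  obtain ⟨-, -, u, v, h⟩ := h
  have hyc := continuousOn_of_hasDeltaDerivAt hγ hd hl fun t ht => (h t ht).1
  have huc := continuousOn_of_hasDeltaDerivAt hγ hd hl fun t ht => (h t ht).2.1
  have hγT : γ ∈ twoSegments γ d l := Or.inl ⟨hγ, le_rfl⟩
  obtain ⟨hy1, hu1, heq1⟩ := h γ hγT
  have hya := ((hasDeltaDerivAt_gap_iff hγ hd hl).1 hy1).1
  have hua := ((hasDeltaDerivAt_gap_iff hγ hd hl).1 hu1).1
  rw [sigma_twoSegments_gap hd hl] at heq1
  refine ⟨u γ, y γ, ?_⟩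
  rintro x (hx | hx)
  · have hsub : uIcc γ x ⊆ Icc 0 γ := by
      rw [uIcc_of_ge hx.2]
      exact Icc_subset_Icc_left hx.1
    have hsubT := hsub.trans (subset_union_left (t := Icc (γ + d) (γ + d + l)))
    have hmem : ∀ t ∈ Ioo (min γ x) (max γ x), t ∈ Ioo 0 γ := fun t ht => by
      rw [min_eq_right hx.2, max_eq_left hx.2] at ht
      exact ⟨hx.1.trans_lt ht.1, ht.2⟩
    have h1 := eq_segSol (z := z) (t₀ := γ) (x := x) (y := y) (u := u) (Q := fun t => y γ * q t)
      (hyc.mono hsubT) (huc.mono hsubT) (continuousOn_const.mul (hq₁.mono hsub))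
      (fun t ht => by
        have ht' := hmem t ht
        have hσ := sigma_twoSegments_left (d := d) (l := l) ⟨ht'.1.le, ht'.2⟩
        exact ((hasDeltaDerivAt_iff_of_sigma_eq hσ).1 (h t (Or.inl ⟨ht'.1.le, ht'.2.le⟩)).1
          ).hasDerivAt (twoSegments_mem_nhds_left ht'))
      (fun t ht => by
        have ht' := hmem t ht
        have hσ := sigma_twoSegments_left (d := d) (l := l) ⟨ht'.1.le, ht'.2⟩
        have h2 := h t (Or.inl ⟨ht'.1.le, ht'.2.le⟩)
        rw [hσ] at h2
        refine (((hasDeltaDerivAt_iff_of_sigma_eq hσ).1 h2.2.1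
          ).hasDerivAt (twoSegments_mem_nhds_left ht')).congr_deriv ?_
        linear_combination -h2.2.2)
    rw [h1, segSol, solS, if_pos hx.2, solC, if_pos hx.2]
    rw [mul_add (y γ), ← intervalIntegral.integral_const_mul]
    simp only [mul_left_comm]
    ring
  · have hxγ : ¬ x ≤ γ := by linarith [hx.1]
    have hsub : uIcc (γ + d) x ⊆ Icc (γ + d) (γ + d + l) := by
      rw [uIcc_of_le hx.1]
      exact Icc_subset_Icc_right hx.2
    have hsubT := hsub.trans (subset_union_right (s := Icc 0 γ))
    have hmem : ∀ t ∈ Ioo (min (γ + d) x) (max (γ + d) x), t ∈ Ioo (γ + d) (γ + d + l) :=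
      fun t ht => by
        rw [min_eq_left hx.1, max_eq_right hx.1] at ht
        exact ⟨ht.1, ht.2.trans_le hx.2⟩
    have h1 := eq_segSol (z := z) (t₀ := γ + d) (x := x) (y := y) (u := u)
      (Q := fun t => y γ * q t)
      (hyc.mono hsubT) (huc.mono hsubT) (continuousOn_const.mul (hq₂.mono hsub))
      (fun t ht => by
        have ht' := Ioo_subset_Icc_self (hmem t ht)
        have hσ := sigma_twoSegments_right hd ht'
        exact ((hasDeltaDerivAt_iff_of_sigma_eq hσ).1 (h t (Or.inr ht')).1
          ).hasDerivAt (twoSegments_mem_nhds_right (hmem t ht)))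
      (fun t ht => by
        have ht' := Ioo_subset_Icc_self (hmem t ht)
        have hσ := sigma_twoSegments_right hd ht'
        have h2 := h t (Or.inr ht')
        rw [hσ] at h2
        refine (((hasDeltaDerivAt_iff_of_sigma_eq hσ).1 h2.2.1
          ).hasDerivAt (twoSegments_mem_nhds_right (hmem t ht))).congr_deriv ?_
        linear_combination -h2.2.2)
    have hya' : y (γ + d) = y γ + u γ * d := by linear_combination hya
    have hua' : u (γ + d) = u γ + (y γ * q γ - z * (y γ + u γ * d)) * d := by
      rw [hya'] at heq1
      linear_combination hua - d * heq1
    rw [h1, segSol, solS, if_neg hxγ, solC, if_neg hxγ, hya', hua']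
    rw [mul_add (y γ), ← intervalIntegral.integral_const_mul]
    simp only [mul_left_comm (y γ) (sinRoot z _)]
    ring

/-- Every linear combination of `S` and `C` is a solution. -/
lemma isSolution_add {γ d l : ℝ} (hγ : 0 ≤ γ) (hd : 0 < d) (hl : 0 ≤ l) {q : ℝ → ℂ}
    (hq₁ : ContinuousOn q (Icc 0 γ)) (hq₂ : ContinuousOn q (Icc (γ + d) (γ + d + l)))
    (z A B : ℂ) :
    IsSolution γ d l q z fun t => A * solS γ d z t + B * solC γ d q z t := by
  have hab : γ + d ≤ γ + d + l := by linarith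
  -- Continuous extensions of the two pieces of `q` to the line.
  set Q₁ : ℝ → ℂ := fun t => B * IccExtend hγ (domRestrict (Icc 0 γ) q) t with hQ₁
  set Q₂ : ℝ → ℂ := fun t => B * IccExtend hab (domRestrict (Icc (γ + d) (γ + d + l)) q) t with hQ₂
  have hQ₁c : Continuous Q₁ := continuous_const.mul hq₁.domRestrict.Icc_extend'
  have hQ₂c : Continuous Q₂ := continuous_const.mul hq₂.domRestrict.Icc_extend'
  have hQ₁q : ∀ t ∈ Icc 0 γ, Q₁ t = B * q t := fun t ht => by
    simp only [hQ₁]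
    rw [IccExtend_of_mem _ _ ht, domRestrict_apply]
  have hQ₂q : ∀ t ∈ Icc (γ + d) (γ + d + l), Q₂ t = B * q t := fun t ht => by
    simp only [hQ₂]
    rw [IccExtend_of_mem _ _ ht, domRestrict_apply]
  set ya : ℂ := B + A * d with hya
  set ua : ℂ := A * (1 - d ^ 2 * z) + B * (d * (q γ - z)) with hua
  set Y₁ := segSol z γ B A Q₁ with hY₁
  set Y₂ := segSol z (γ + d) ya ua Q₂ with hY₂
  set U₁ := segSolDeriv z γ B A Q₁ with hU₁
  set U₂ := segSolDeriv z (γ + d) ya ua Q₂ with hU₂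
  have hYd₁ : ∀ x, HasDerivAt Y₁ (U₁ x) x := hasDerivAt_segSol z γ B A hQ₁c
  have hYd₂ : ∀ x, HasDerivAt Y₂ (U₂ x) x := hasDerivAt_segSol z (γ + d) ya ua hQ₂c
  have hUd₁ : ∀ x, HasDerivAt U₁ (Q₁ x - z * Y₁ x) x := hasDerivAt_segSolDeriv z γ B A hQ₁c
  have hUd₂ : ∀ x, HasDerivAt U₂ (Q₂ x - z * Y₂ x) x :=
    hasDerivAt_segSolDeriv z (γ + d) ya ua hQ₂c
  have hY₁γ : Y₁ γ = B := by simp [hY₁, segSol]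
  have hU₁γ : U₁ γ = A := by simp [hU₁, segSolDeriv]
  have hY₂a : Y₂ (γ + d) = ya := by simp [hY₂, segSol]
  have hU₂a : U₂ (γ + d) = ua := by simp [hU₂, segSolDeriv]
  set y : ℝ → ℂ := fun t => A * solS γ d z t + B * solC γ d q z t with hy
  have hy₁ : EqOn y Y₁ (Icc 0 γ) := fun x hx => by
    have h1 : ∫ t in γ..x, sinRoot z (x - t) * Q₁ t
        = B * ∫ t in γ..x, sinRoot z (x - t) * q t := by
      rw [← intervalIntegral.integral_const_mul]
      refine intervalIntegral.integral_congr fun t ht => ?_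
      rw [uIcc_of_ge hx.2] at ht
      rw [hQ₁q t ⟨hx.1.trans ht.1, ht.2⟩]
      ring
    simp only [hy, hY₁, segSol, solS, solC, if_pos hx.2, h1]
    ring
  have hy₂ : EqOn y Y₂ (Icc (γ + d) (γ + d + l)) := fun x hx => by
    have h1 : ∫ t in (γ + d)..x, sinRoot z (x - t) * Q₂ t
        = B * ∫ t in (γ + d)..x, sinRoot z (x - t) * q t := by
      rw [← intervalIntegral.integral_const_mul]
      refine intervalIntegral.integral_congr fun t ht => ?_
      rw [uIcc_of_le hx.1] at ht
      rw [hQ₂q t ⟨ht.1, ht.2.trans hx.2⟩]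
      ring
    have hxγ : ¬ x ≤ γ := by linarith [hx.1]
    simp only [hy, hY₂, segSol, solS, solC, if_neg hxγ, h1, hya, hua]
    ring
  set u : ℝ → ℂ := fun t => if t ≤ γ then U₁ t else U₂ t with hu
  have hu₁ : EqOn u U₁ (Icc 0 γ) := fun x hx => by simp only [hu, if_pos hx.2]
  have hu₂ : EqOn u U₂ (Icc (γ + d) (γ + d + l)) := fun x hx => by
    have hxγ : ¬ x ≤ γ := by linarith [hx.1]
    simp only [hu, if_neg hxγ]
  set T := twoSegments γ d l with hT
  have hσ₁ : ∀ t ∈ Ico 0 γ, sigma T t = t := fun t ht => sigma_twoSegments_left ht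
  have hσγ : sigma T γ = γ + d := sigma_twoSegments_gap hd hl
  have hσ₂ : ∀ t ∈ Icc (γ + d) (γ + d + l), sigma T t = t := fun t ht =>
    sigma_twoSegments_right hd ht
  -- Within `T`, a neighbourhood of a point of one segment lies in that segment.
  have hnear₁ : ∀ t ∈ Icc 0 γ, ∀ f g : ℝ → ℂ, EqOn f g (Icc 0 γ) → f =ᶠ[𝓝[T] t] g := by
    intro t ht f g hfg
    rw [EventuallyEq, eventually_nhdsWithin_iff]
    filter_upwards [Iio_mem_nhds (show t < γ + d by linarith [ht.2])] with s hs hsT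
    rcases hsT with h | h
    · exact hfg h
    · exact absurd h.1 (not_le.2 hs)
  have hnear₂ : ∀ t ∈ Icc (γ + d) (γ + d + l), ∀ f g : ℝ → ℂ,
      EqOn f g (Icc (γ + d) (γ + d + l)) → f =ᶠ[𝓝[T] t] g := by
    intro t ht f g hfg
    rw [EventuallyEq, eventually_nhdsWithin_iff]
    filter_upwards [Ioi_mem_nhds (show γ < t by linarith [ht.1])] with s hs hsT
    rcases hsT with h | h
    · exact absurd h.2 (not_le.2 hs)
    · exact hfg h
  have hleft : ∀ t ∈ Ico 0 γ, ∀ (f g : ℝ → ℂ) (m : ℂ), EqOn f g (Icc 0 γ) → HasDerivAt g m t →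
      HasDeltaDerivAt T f m t := fun t ht f g m hfg hg => by
    rw [hasDeltaDerivAt_iff_of_sigma_eq (sigma_twoSegments_left ht)]
    have ht' := Ico_subset_Icc_self ht
    exact hg.hasDerivWithinAt.congr_of_eventuallyEq (hnear₁ t ht' f g hfg) (hfg ht')
  have hright : ∀ t ∈ Icc (γ + d) (γ + d + l), ∀ (f g : ℝ → ℂ) (m : ℂ),
      EqOn f g (Icc (γ + d) (γ + d + l)) → HasDerivAt g m t →
      HasDeltaDerivAt T f m t := fun t ht f g m hfg hg => by
    rw [hasDeltaDerivAt_iff_of_sigma_eq (sigma_twoSegments_right hd ht)]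
    exact hg.hasDerivWithinAt.congr_of_eventuallyEq (hnear₂ t ht f g hfg) (hfg ht)
  have hgap : ∀ (f g : ℝ → ℂ) (m : ℂ), EqOn f g (Icc 0 γ) → ContinuousAt g γ →
      f (γ + d) - f γ = m * d → HasDeltaDerivAt T f m γ := fun f g m hfg hg h => by
    have ht' : γ ∈ Icc 0 γ := ⟨hγ, le_rfl⟩
    exact (hasDeltaDerivAt_gap_iff hγ hd hl).2 ⟨h, hg.continuousWithinAt.congr_of_eventuallyEq
      (hnear₁ γ ht' f g hfg) (hfg ht')⟩
  have hyγ : y γ = B := by rw [hy₁ ⟨hγ, le_rfl⟩, hY₁γ]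
  have hya' : y (γ + d) = ya := by rw [hy₂ ⟨le_rfl, hab⟩, hY₂a]
  have huγ : u γ = A := by rw [hu₁ ⟨hγ, le_rfl⟩, hU₁γ]
  have hua' : u (γ + d) = ua := by rw [hu₂ ⟨le_rfl, hab⟩, hU₂a]
  refine ⟨(contDiff_segSol z γ B A hQ₁c).contDiffOn.congr hy₁,
    (contDiff_segSol z (γ + d) ya ua hQ₂c).contDiffOn.congr hy₂, u,
    fun t => y γ * q t - z * y (sigma T t), ?_⟩
  rintro t (ht | ht)
  · rcases ht.2.lt_or_eq with h | rfl
    · refine ⟨hleft t ⟨ht.1, h⟩ y Y₁ _ hy₁ ((hYd₁ t).congr_deriv (hu₁ ht).symm),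
        hleft t ⟨ht.1, h⟩ u U₁ _ hu₁ ((hUd₁ t).congr_deriv ?_), by ring⟩
      beta_reduce
      rw [hσ₁ t ⟨ht.1, h⟩, hQ₁q t ht, hy₁ ht, hyγ]
    · refine ⟨hgap y Y₁ _ hy₁ (hYd₁ t).continuousAt ?_,
        hgap u U₁ _ hu₁ (hUd₁ t).continuousAt ?_, by ring⟩
      · rw [hya', hyγ, huγ, hya]
        ring
      · beta_reduce
        rw [hσγ, hua', huγ, hyγ, hya', hua, hya]
        ring
  · refine ⟨hright t ht y Y₂ _ hy₂ ((hYd₂ t).congr_deriv (hu₂ ht).symm),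
      hright t ht u U₂ _ hu₂ ((hUd₂ t).congr_deriv ?_), by ring⟩
    beta_reduce
    rw [hσ₂ t ht, hQ₂q t ht, hy₂ ht, hyγ]

/-- The boundary conditions on `A S + B C` are a homogeneous linear system for `(A, B)` with
determinant `charFun`. Its non-zero solutions give functions that do not vanish on `T`, because
`C(γ) = 1`, `S(γ) = 0` and `S(γ + d) = d`. -/
lemma isEigenvalue_iff {γ d l : ℝ} (hγ : 0 ≤ γ) (hd : 0 < d) (hl : 0 ≤ l) {q : ℝ → ℂ}
    (hq₁ : ContinuousOn q (Icc 0 γ)) (hq₂ : ContinuousOn q (Icc (γ + d) (γ + d + l))) (z : ℂ) :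
    IsEigenvalue γ d l q z ↔ charFun γ d l q z = 0 := by
  have h0T : (0 : ℝ) ∈ twoSegments γ d l := Or.inl ⟨le_rfl, hγ⟩
  have hbT : γ + d + l ∈ twoSegments γ d l := Or.inr ⟨by linarith, le_rfl⟩
  have hγT : γ ∈ twoSegments γ d l := Or.inl ⟨hγ, le_rfl⟩
  have haT : γ + d ∈ twoSegments γ d l := Or.inr ⟨le_rfl, by linarith⟩
  have hSγ : solS γ d z γ = 0 := by simp [solS]
  have hCγ : solC γ d q z γ = 1 := by simp [solC]
  have hSa : solS γ d z (γ + d) = d := by simp [solS, hd]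
  rw [charFun, ← Matrix.exists_mulVec_eq_zero_iff]
  constructor
  · rintro ⟨y, hy, hy0, hyb, t, ht, hyt⟩
    obtain ⟨A, B, hAB⟩ := hy.exists_eq hγ hd hl hq₁ hq₂
    refine ⟨![A, B], fun h => hyt ?_, ?_⟩
    · have hA : A = 0 := congrFun h 0
      have hB : B = 0 := congrFun h 1
      rw [hAB t ht, hA, hB]
      ring
    · rw [hAB _ h0T] at hy0
      rw [hAB _ hbT] at hyb
      funext i
      fin_cases i
      · simpa [Matrix.mulVec, dotProduct, mul_comm] using hy0
      · simpa [Matrix.mulVec, dotProduct, mul_comm] using hyb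
  · rintro ⟨w, hw, h⟩
    have h0 := congrFun h 0
    have h1 := congrFun h 1
    simp only [Matrix.mulVec, dotProduct, Fin.sum_univ_two, Matrix.of_apply, Matrix.cons_val',
      Matrix.cons_val_zero, Matrix.cons_val_one, Matrix.cons_val_fin_one, Pi.zero_apply] at h0 h1
    refine ⟨_, isSolution_add hγ hd hl hq₁ hq₂ z (w 0) (w 1), ?_, ?_, ?_⟩
    · linear_combination h0
    · linear_combination h1
    · by_cases hw1 : w 1 = 0
      · have hw0 : w 0 ≠ 0 := by
          intro h2
          apply hw
          funext i
          fin_cases i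
          · exact h2
          · exact hw1
        refine ⟨γ + d, haT, ?_⟩
        rw [hw1, hSa, zero_mul, add_zero]
        exact mul_ne_zero hw0 (by exact_mod_cast hd.ne')
      · refine ⟨γ, hγT, ?_⟩
        rwa [hSγ, hCγ, mul_zero, zero_add, mul_one]

/-! ### Counting the zeros of the characteristic function -/

lemma norm_sin_sq (w : ℂ) : ‖sin w‖ ^ 2 = Real.sin w.re ^ 2 + Real.sinh w.im ^ 2 := by
  have h : sin w = ((Real.sin w.re * Real.cosh w.im : ℝ) : ℂ)
      + ((Real.cos w.re * Real.sinh w.im : ℝ) : ℂ) * I := by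
    rw [sin_eq]
    push_cast
    ring
  rw [h, ← normSq_eq_norm_sq, normSq_add_mul_I]
  have h1 := Real.sin_sq_add_cos_sq w.re
  have h2 := Real.cosh_sq w.im
  linear_combination (Real.sin w.re) ^ 2 * h2 + (Real.sinh w.im) ^ 2 * h1

/-- Away from its zeros the sine is at least a multiple of `exp |Im w|`. -/
lemma exists_int_min_mul_exp_le (w : ℂ) :
    ∃ m : ℤ, min 1 ‖w - m * Real.pi‖ * Real.exp |w.im| ≤ 5 * ‖sin w‖ := by
  have hsq := norm_sin_sq w
  have hpi := Real.pi_pos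
  refine ⟨round (w.re / Real.pi), ?_⟩
  set m : ℤ := round (w.re / Real.pi) with hm
  rcases le_or_gt 1 |w.im| with hy | hy
  · have h1 : Real.sinh |w.im| ≤ ‖sin w‖ := by
      refine (sq_le_sq₀ (Real.sinh_nonneg_iff.2 (abs_nonneg _)) (norm_nonneg _)).1 ?_
      rw [hsq, ← Real.abs_sinh, sq_abs]
      nlinarith [sq_nonneg (Real.sin w.re)]
    have h2 : (2 : ℝ) ≤ Real.exp |w.im| := by
      have := Real.add_one_le_exp |w.im|
      linarith
    have h3 : Real.exp |w.im| / 5 ≤ Real.sinh |w.im| := by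
      rw [Real.sinh_eq]
      have h4 : Real.exp (-|w.im|) ≤ 1 / 2 := by
        rw [Real.exp_neg, ← one_div]
        exact one_div_le_one_div_of_le two_pos h2
      linarith
    calc min 1 ‖w - m * Real.pi‖ * Real.exp |w.im| ≤ 1 * Real.exp |w.im| := by
          gcongr
          exact min_le_left _ _
      _ ≤ 5 * ‖sin w‖ := by linarith
  · set x' : ℝ := w.re - m * Real.pi with hx'
    have hx1 : |x'| ≤ Real.pi / 2 := by
      have h1 := abs_sub_round (w.re / Real.pi)
      rw [← hm] at h1
      have h2 : x' = (w.re / Real.pi - m) * Real.pi := by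
        rw [hx']
        field_simp
      rw [h2, abs_mul, abs_of_pos hpi]
      nlinarith
    have hsin : Real.sin w.re ^ 2 = |Real.sin x'| ^ 2 := by
      rw [sq_abs, hx', Real.sin_sub_int_mul_pi]
      rcases Int.even_or_odd m with h | h
      · simp [h.neg_one_zpow]
      · simp [h.neg_one_zpow]
    have h1 := Real.mul_abs_le_abs_sin hx1
    have h2 : |w.im| ≤ |Real.sinh w.im| := by
      rw [Real.abs_sinh]
      exact Real.self_le_sinh_iff.2 (abs_nonneg _)
    have hnorm : ‖w - m * Real.pi‖ ^ 2 = |x'| ^ 2 + |w.im| ^ 2 := by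
      rw [← normSq_eq_norm_sq, normSq_apply, sq_abs, sq_abs, hx']
      simp
      ring
    have hp2 : 2 / Real.pi ≤ 1 := by
      rw [div_le_one hpi]
      linarith [Real.pi_gt_three]
    have hp0 : 0 < 2 / Real.pi := by positivity
    have h3 : 2 / Real.pi * ‖w - m * Real.pi‖ ≤ ‖sin w‖ := by
      refine (sq_le_sq₀ (by positivity) (norm_nonneg _)).1 ?_
      rw [mul_pow, hnorm, hsq, hsin, ← sq_abs (Real.sinh w.im)]
      have h4 : (2 / Real.pi * |x'|) ^ 2 ≤ |Real.sin x'| ^ 2 := by gcongr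
      have h5 : (2 / Real.pi * |w.im|) ^ 2 ≤ |Real.sinh w.im| ^ 2 := by
        gcongr
        nlinarith [abs_nonneg w.im]
      nlinarith
    have h4 : Real.exp |w.im| ≤ 2.7182818286 :=
      (Real.exp_le_exp.2 hy.le).trans Real.exp_one_lt_d9.le
    have h5 : (2.7182818286 : ℝ) ≤ 5 * (2 / Real.pi) := by
      rw [mul_div_assoc', le_div_iff₀ hpi]
      linarith [Real.pi_lt_d2]
    calc min 1 ‖w - m * Real.pi‖ * Real.exp |w.im| ≤ ‖w - m * Real.pi‖ * (5 * (2 / Real.pi)) := by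
          gcongr
          · exact min_le_right _ _
          · exact h4.trans h5
      _ = 5 * (2 / Real.pi * ‖w - m * Real.pi‖) := by ring
      _ ≤ 5 * ‖sin w‖ := by linarith

/-- The characteristic function in the case `γ = l`. With `ρ² = z`, the first summand is
`d² ρ sin (2 l ρ) / 2`, and the rest is of order one relative to `exp (2 l |Im ρ|)`. -/
lemma charFun_eq_of_eq {d l : ℝ} (hd : 0 < d) (hl : 0 ≤ l) (q : ℝ → ℂ) (z : ℂ) :
    charFun l d l q z = d ^ 2 / 2 * (z * sinRoot z (2 * l)) +
      (d * z * sinRoot z l ^ 2 - d * cosRoot z l ^ 2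
        - 2 * sinRoot z l * cosRoot z l - d * q l * sinRoot z l ^ 2
        - sinRoot z l * (∫ t in (l + d)..(l + d + l), sinRoot z (l + d + l - t) * q t)
        - d * cosRoot z l * (∫ t in (0 : ℝ)..l, sinRoot z t * q t)
        - sinRoot z l * (∫ t in (0 : ℝ)..l, sinRoot z t * q t)
        + d ^ 2 * z * sinRoot z l * ∫ t in (0 : ℝ)..l, sinRoot z t * q t) := by
  have h1 : ∫ t in l..0, sinRoot z (0 - t) * q t = ∫ t in (0 : ℝ)..l, sinRoot z t * q t := by
    rw [intervalIntegral.integral_symm, ← intervalIntegral.integral_neg]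
    refine intervalIntegral.integral_congr fun t _ => ?_
    simp
  have h2 : sinRoot z (2 * l) = 2 * sinRoot z l * cosRoot z l := by
    have := sinRoot_sub z l (-l)
    rw [sinRoot_neg, cosRoot_neg, sub_neg_eq_add, ← two_mul] at this
    rw [this]
    ring
  rw [charFun_eq l hl hd hl, h1, h2, sinRoot_neg, cosRoot_neg]
  ring

lemma norm_cosRoot_le (ρ : ℂ) {x l : ℝ} (hx : |x| ≤ l) :
    ‖cosRoot (ρ ^ 2) x‖ ≤ Real.exp (l * |ρ.im|) := by
  rw [cosRoot_sq]
  refine (norm_cos_le_exp_abs_im _).trans (Real.exp_le_exp.2 ?_)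
  rw [im_mul_ofReal, abs_mul, mul_comm]
  gcongr

lemma norm_sinRoot_le {ρ : ℂ} (hρ : ρ ≠ 0) {x l : ℝ} (hx : |x| ≤ l) :
    ‖sinRoot (ρ ^ 2) x‖ ≤ Real.exp (l * |ρ.im|) / ‖ρ‖ := by
  rw [sinRoot_sq hρ, norm_div]
  gcongr
  refine (norm_sin_le_exp_abs_im _).trans (Real.exp_le_exp.2 ?_)
  rw [im_mul_ofReal, abs_mul, mul_comm]
  gcongr

lemma norm_integral_sinRoot_le {ρ : ℂ} (hρ : ρ ≠ 0) {φ : ℝ → ℝ} {q : ℝ → ℂ} {α β l M : ℝ}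
    (hαβ : α ≤ β) (hφ : ∀ t ∈ Icc α β, |φ t| ≤ l) (hq : ∀ t ∈ Icc α β, ‖q t‖ ≤ M) :
    ‖∫ t in α..β, sinRoot (ρ ^ 2) (φ t) * q t‖ ≤
      M * (β - α) * (Real.exp (l * |ρ.im|) / ‖ρ‖) := by
  have h := intervalIntegral.norm_integral_le_of_norm_le_const (a := α) (b := β)
    (f := fun t => sinRoot (ρ ^ 2) (φ t) * q t) (C := Real.exp (l * |ρ.im|) / ‖ρ‖ * M)
    (fun t ht => by
      rw [uIoc_of_le hαβ] at ht
      have ht' := Ioc_subset_Icc_self ht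
      rw [norm_mul]
      exact mul_le_mul (norm_sinRoot_le hρ (hφ t ht')) (hq t ht') (norm_nonneg _) (by positivity))
  rw [abs_of_nonneg (sub_nonneg.2 hαβ)] at h
  linarith

/-- The leading term of the characteristic function dominates: the rest is one order smaller in
`ρ`, where `ρ² = z`. -/
lemma exists_norm_charFun_sub_le {d l : ℝ} (hd : 0 < d) (hl : 0 < l) {q : ℝ → ℂ}
    (hq₁ : ContinuousOn q (Icc 0 l)) (hq₂ : ContinuousOn q (Icc (l + d) (l + d + l))) :
    ∃ K : ℝ, 0 < K ∧ ∀ ρ : ℂ, 1 ≤ ‖ρ‖ →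
      ‖charFun l d l q (ρ ^ 2) - d ^ 2 / 2 * (ρ ^ 2 * sinRoot (ρ ^ 2) (2 * l))‖ ≤
        K * Real.exp (2 * l * |ρ.im|) := by
  obtain ⟨M₁, hM₁⟩ := isCompact_Icc.exists_bound_of_continuousOn hq₁
  obtain ⟨M₂, hM₂⟩ := isCompact_Icc.exists_bound_of_continuousOn hq₂
  set M := max M₁ M₂ with hM
  have hq₁' : ∀ t ∈ Icc 0 l, ‖q t‖ ≤ M := fun t ht => (hM₁ t ht).trans (le_max_left _ _)
  have hq₂' : ∀ t ∈ Icc (l + d) (l + d + l), ‖q t‖ ≤ M := fun t ht =>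
    (hM₂ t ht).trans (le_max_right _ _)
  have hM0 : 0 ≤ M := (norm_nonneg _).trans (hq₁' l ⟨hl.le, le_rfl⟩)
  refine ⟨d + d + 2 + d * M + M * l + d * (M * l) + M * l + d ^ 2 * (M * l), by positivity,
    fun ρ hρ1 => ?_⟩
  have hρ : ρ ≠ 0 := norm_pos_iff.1 (by linarith)
  set E := Real.exp (l * |ρ.im|) with hE
  have hEE : Real.exp (2 * l * |ρ.im|) = E * E := by
    rw [hE, ← Real.exp_add]
    congr 1
    ring
  have hE0 : 0 < E := Real.exp_pos _
  have hEρ : E / ‖ρ‖ ≤ E := div_le_self hE0.le hρ1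
  set s := sinRoot (ρ ^ 2) l with hs
  set c := cosRoot (ρ ^ 2) l with hc
  have hcE : ‖c‖ ≤ E := norm_cosRoot_le ρ (abs_of_pos hl).le
  have hsE' : ‖s‖ ≤ E / ‖ρ‖ := norm_sinRoot_le hρ (abs_of_pos hl).le
  have hsE : ‖s‖ ≤ E := hsE'.trans hEρ
  have hρs : ‖ρ * s‖ ≤ E := by
    rw [norm_mul]
    calc ‖ρ‖ * ‖s‖ ≤ ‖ρ‖ * (E / ‖ρ‖) := by gcongr
      _ = E := by field_simp
  set I₁ := ∫ t in (0 : ℝ)..l, sinRoot (ρ ^ 2) t * q t with hI₁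
  set I₂ := ∫ t in (l + d)..(l + d + l), sinRoot (ρ ^ 2) (l + d + l - t) * q t with hI₂
  have hI₁' : ‖I₁‖ ≤ M * l * (E / ‖ρ‖) := by
    have := norm_integral_sinRoot_le hρ (φ := fun t => t) (l := l) hl.le
      (fun t ht => by rw [abs_of_nonneg ht.1]; exact ht.2) hq₁'
    rwa [sub_zero] at this
  have hI₂' : ‖I₂‖ ≤ M * l * (E / ‖ρ‖) := by
    have := norm_integral_sinRoot_le hρ (φ := fun t => l + d + l - t) (l := l) (by linarith)
      (fun t ht => by rw [abs_le]; constructor <;> linarith [ht.1, ht.2]) hq₂'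
    rwa [add_sub_cancel_left] at this
  have hI₁E : ‖I₁‖ ≤ M * l * E := hI₁'.trans (by gcongr)
  have hI₂E : ‖I₂‖ ≤ M * l * E := hI₂'.trans (by gcongr)
  have hρI₁ : ‖ρ * I₁‖ ≤ M * l * E := by
    rw [norm_mul]
    calc ‖ρ‖ * ‖I₁‖ ≤ ‖ρ‖ * (M * l * (E / ‖ρ‖)) := by gcongr
      _ = M * l * E := by field_simp
  have hdn : ‖(d : ℂ)‖ = d := by rw [norm_real, Real.norm_of_nonneg hd.le]
  have hql : ‖q l‖ ≤ M := hq₁' l ⟨hl.le, le_rfl⟩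
  rw [charFun_eq_of_eq hd hl.le, add_sub_cancel_left, hEE]
  rw [show d * ρ ^ 2 * s ^ 2 - d * c ^ 2 - 2 * s * c - d * q l * s ^ 2 - s * I₂ - d * c * I₁ - s * I₁
      + d ^ 2 * ρ ^ 2 * s * I₁ = d * ((ρ * s) * (ρ * s)) - d * (c * c) - 2 * (s * c)
      - d * (q l * (s * s)) - s * I₂ - d * (c * I₁) - s * I₁ + d ^ 2 * ((ρ * s) * (ρ * I₁)) by ring]
  have b1 : ‖(d : ℂ) * ((ρ * s) * (ρ * s))‖ ≤ d * (E * E) := by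
    rw [norm_mul, norm_mul, hdn]; gcongr
  have b2 : ‖(d : ℂ) * (c * c)‖ ≤ d * (E * E) := by rw [norm_mul, norm_mul, hdn]; gcongr
  have b3 : ‖2 * (s * c)‖ ≤ 2 * (E * E) := by
    rw [norm_mul, norm_mul, Complex.norm_ofNat]; gcongr
  have b4 : ‖(d : ℂ) * (q l * (s * s))‖ ≤ d * (M * (E * E)) := by
    rw [norm_mul, norm_mul, norm_mul, hdn]; gcongr
  have b5 : ‖s * I₂‖ ≤ E * (M * l * E) := by rw [norm_mul]; gcongr
  have b6 : ‖(d : ℂ) * (c * I₁)‖ ≤ d * (E * (M * l * E)) := by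
    rw [norm_mul, norm_mul, hdn]; gcongr
  have b7 : ‖s * I₁‖ ≤ E * (M * l * E) := by rw [norm_mul]; gcongr
  have b8 : ‖(d : ℂ) ^ 2 * ((ρ * s) * (ρ * I₁))‖ ≤ d ^ 2 * (E * (M * l * E)) := by
    rw [norm_mul, norm_mul, norm_pow, hdn]; gcongr
  refine (norm_add_le _ _).trans ?_
  refine (add_le_add ((norm_sub_le _ _).trans (add_le_add ((norm_sub_le _ _).trans (add_le_add
    ((norm_sub_le _ _).trans (add_le_add ((norm_sub_le _ _).trans (add_le_add ((norm_sub_le _ _).trans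
    (add_le_add ((norm_sub_le _ _).trans (add_le_add b1 b2)) b3)) b4)) b5)) b6)) b7)) b8).trans ?_
  apply le_of_eq
  ring

/-- The radius, in the `z`-plane, of the circle passing between the `n`-th and the `n + 1`-st
zero of the leading term. -/
noncomputable def midRadius (l : ℝ) (n : ℕ) : ℝ := (Real.pi * (n + 1 / 2) / (2 * l)) ^ 2

/-- The zeros of the leading term `z sinRoot z (2 l)` are the simple zeros `(π n / 2 l)²`. -/
lemma exists_zeros_leading {d l : ℝ} (hd : 0 < d) (hl : 0 < l) (N : ℕ) :
    ∃ W : Finset ℂ, (∀ a, a ∈ W ↔ ‖a‖ < midRadius l N ∧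
        (fun z : ℂ => (d : ℂ) ^ 2 / 2 * (z * sinRoot z (2 * l))) a = 0) ∧
      ∑ a ∈ W, analyticOrderNatAt (fun z : ℂ => (d : ℂ) ^ 2 / 2 * (z * sinRoot z (2 * l))) a
        = N + 1 := by
  classical
  set f : ℂ → ℂ := fun z => (d : ℂ) ^ 2 / 2 * (z * sinRoot z (2 * l)) with hf
  have hpi := Real.pi_pos
  have hdC : (d : ℂ) ≠ 0 := by exact_mod_cast hd.ne'
  have hlC : (l : ℂ) ≠ 0 := by exact_mod_cast hl.ne'
  have hpiC : (Real.pi : ℂ) ≠ 0 := by exact_mod_cast hpi.ne'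
  have hfd : Differentiable ℂ f := by
    have := differentiable_sinRoot (2 * l)
    fun_prop
  set ζ : ℕ → ℂ := fun n => (((Real.pi * n / (2 * l)) ^ 2 : ℝ) : ℂ) with hζ
  have hζinj : Function.Injective ζ := by
    intro n m h
    have h1 : (Real.pi * n / (2 * l)) ^ 2 = (Real.pi * m / (2 * l)) ^ 2 :=
      ofReal_injective h
    have h2 := (sq_eq_sq₀ (by positivity) (by positivity)).1 h1
    have h3 : (n : ℝ) = m := by
      field_simp at h2
      exact h2
    exact_mod_cast h3
  have hζn : ∀ n, ‖ζ n‖ < midRadius l N ↔ n ≤ N := by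
    intro n
    simp only [hζ]
    rw [norm_real, Real.norm_of_nonneg (by positivity), midRadius,
      sq_lt_sq₀ (by positivity) (by positivity), div_lt_div_iff_of_pos_right (by positivity),
      mul_lt_mul_iff_right₀ hpi]
    constructor
    · intro h
      by_contra h'
      have : (N : ℝ) + 1 ≤ n := by exact_mod_cast (not_le.1 h')
      linarith
    · intro h
      have : (n : ℝ) ≤ N := by exact_mod_cast h
      linarith
  have hcomp : ∀ ρ : ℂ, f (ρ ^ 2) = (d : ℂ) ^ 2 / 2 * (ρ * sin (ρ * (2 * l : ℝ))) := by
    intro ρ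
    simp only [hf]
    rcases eq_or_ne ρ 0 with rfl | hρ
    · simp
    · rw [sinRoot_sq hρ]
      field_simp
  have hzero : ∀ z, f z = 0 ↔ ∃ n, ζ n = z := by
    intro z
    obtain ⟨ρ, rfl⟩ := exists_sq_eq z
    rw [hcomp]
    constructor
    · intro h
      rw [mul_eq_zero, mul_eq_zero] at h
      rcases h with h | h | h
      · exact absurd h (by simp [hdC])
      · exact ⟨0, by simp [hζ, h]⟩
      · obtain ⟨k, hk⟩ := sin_eq_zero_iff.1 h
        refine ⟨k.natAbs, ?_⟩
        have h1 : ρ = k * Real.pi / (2 * l) := by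
          rw [← hk]
          push_cast
          field_simp
        have h2 : ((k.natAbs : ℂ)) ^ 2 = (k : ℂ) ^ 2 := by
          obtain ⟨j, h | h⟩ := k.eq_nat_or_neg
          · simp [h]
          · simp [h]
        simp only [hζ]
        push_cast
        rw [h1, div_pow, div_pow, mul_pow, mul_pow, h2]
        ring
    · rintro ⟨n, hn⟩
      have h1 : ρ ^ 2 = ((Real.pi * n / (2 * l) : ℝ) : ℂ) ^ 2 := by
        rw [← hn]
        simp only [hζ]
        push_cast
        ring
      have h2 : sin (((Real.pi * n / (2 * l) : ℝ) : ℂ) * (2 * l : ℝ)) = 0 := by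
        rw [← ofReal_mul, div_mul_cancel₀ _ (by positivity), sin_eq_zero_iff]
        exact ⟨n, by push_cast; ring⟩
      rw [← hcomp, h1, hcomp, h2, mul_zero, mul_zero]
  have hord : ∀ n, analyticOrderNatAt f (ζ n) = 1 := by
    intro n
    have hder : deriv f (ζ n) ≠ 0 := by
      rcases Nat.eq_zero_or_pos n with rfl | hn
      · have h0 : ζ 0 = 0 := by simp [hζ]
        have h1 : HasDerivAt f ((d : ℂ) ^ 2 / 2 * (1 * sinRoot 0 (2 * l)
            + 0 * deriv (fun z => sinRoot z (2 * l)) 0)) 0 :=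
          ((hasDerivAt_id (0 : ℂ)).mul
            (differentiable_sinRoot (2 * l) 0).hasDerivAt).const_mul _
        rw [h0, h1.deriv, sinRoot_zero_left]
        push_cast
        simp [hdC, hlC]
      · set r : ℂ := ((Real.pi * n / (2 * l) : ℝ) : ℂ) with hr
        have hr0 : r ≠ 0 := by
          rw [hr]
          have : (0 : ℝ) < n := by exact_mod_cast hn
          exact_mod_cast (by positivity : Real.pi * n / (2 * l) ≠ 0)
        have hζr : ζ n = r ^ 2 := by
          simp only [hζ, hr]
          push_cast
          ring
        have hrl : r * (2 * l : ℝ) = n * Real.pi := by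
          rw [hr]
          push_cast
          field_simp
        intro h0
        have h1 : HasDerivAt (fun ρ : ℂ => f (ρ ^ 2)) 0 r := by
          have h2 : HasDerivAt f 0 (r ^ 2) := by
            rw [← h0, hζr]
            exact (hfd _).hasDerivAt
          exact (h2.comp r (hasDerivAt_pow 2 r)).congr_deriv (zero_mul _)
        have h3 : HasDerivAt (fun ρ : ℂ => f (ρ ^ 2)) ((d : ℂ) ^ 2 / 2 *
            (1 * sin (r * (2 * l : ℝ)) + r * (cos (r * (2 * l : ℝ)) * (1 * (2 * l : ℝ))))) r := by
          rw [show (fun ρ : ℂ => f (ρ ^ 2)) = _ from funext hcomp]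
          exact ((hasDerivAt_id r).mul ((hasDerivAt_id r).mul_const _).csin).const_mul _
        have h4 := h1.unique h3
        have hs : sin ((n : ℂ) * Real.pi) = 0 := by exact_mod_cast sin_nat_mul_pi n
        have hc : cos ((n : ℂ) * Real.pi) ≠ 0 := by
          intro hc
          have := sin_sq_add_cos_sq ((n : ℂ) * Real.pi)
          rw [hs, hc] at this
          simp at this
        rw [hrl, hs] at h4
        simp [hdC, hlC, hr0, hc] at h4
    have h1 := (hfd.analyticAt (ζ n)).analyticOrderAt_eq_one_of_zero_deriv_ne_zero
      ((hzero _).2 ⟨n, rfl⟩) hder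
    rw [analyticOrderNatAt, h1]
    rfl
  refine ⟨(Finset.range (N + 1)).image ζ, fun a => ?_, ?_⟩
  · rw [Finset.mem_image, hzero]
    constructor
    · rintro ⟨n, hn, rfl⟩
      exact ⟨(hζn n).2 (by simpa [Nat.lt_succ_iff] using hn), n, rfl⟩
    · rintro ⟨h, n, rfl⟩
      exact ⟨n, by simpa [Nat.lt_succ_iff] using (hζn n).1 h, rfl⟩
  · rw [Finset.sum_image fun _ _ _ _ h => hζinj h]
    simp [hord]

lemma abs_im_two_mul (l : ℝ) (hl : 0 ≤ l) (ρ : ℂ) :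
    |(2 * l * ρ : ℂ).im| = 2 * l * |ρ.im| := by
  rw [show (2 * l * ρ : ℂ) = ((2 * l : ℝ) : ℂ) * ρ by push_cast; ring, im_ofReal_mul, abs_mul,
    abs_of_nonneg (by positivity)]

lemma norm_leading (d l : ℝ) (hd : 0 < d) {ρ : ℂ} (hρ : ρ ≠ 0) :
    ‖(d : ℂ) ^ 2 / 2 * (ρ ^ 2 * sinRoot (ρ ^ 2) (2 * l))‖
      = d ^ 2 / 2 * (‖ρ‖ * ‖sin (2 * l * ρ)‖) := by
  have h : (d : ℂ) ^ 2 / 2 * (ρ ^ 2 * sinRoot (ρ ^ 2) (2 * l))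
      = (d : ℂ) ^ 2 / 2 * (ρ * sin (2 * l * ρ)) := by
    rw [sinRoot_sq hρ]
    push_cast
    rw [mul_comm ρ (2 * (l : ℂ))]
    field_simp
  rw [h, norm_mul, norm_mul, norm_div, norm_pow, norm_real, Real.norm_of_nonneg hd.le,
    Complex.norm_ofNat]

lemma tendsto_midRadius {l : ℝ} (hl : 0 < l) : Tendsto (midRadius l) atTop atTop := by
  refine (tendsto_pow_atTop two_ne_zero).comp ?_
  refine Tendsto.atTop_div_const (by positivity) ?_
  refine Tendsto.const_mul_atTop Real.pi_pos ?_
  exact tendsto_atTop_add_const_right _ _ tendsto_natCast_atTop_atTop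

lemma midRadius_lt {l : ℝ} (hl : 0 < l) (n : ℕ) : midRadius l n < midRadius l (n + 1) := by
  have := Real.pi_pos
  unfold midRadius
  push_cast
  gcongr
  linarith

/-- For large `n` the characteristic function has exactly `n + 1` zeros in the disk of radius
`midRadius l n`, by comparison with its leading term. -/
lemma exists_count_charFun {d l : ℝ} (hd : 0 < d) (hl : 0 < l) {q : ℝ → ℂ}
    (hq₁ : ContinuousOn q (Icc 0 l)) (hq₂ : ContinuousOn q (Icc (l + d) (l + d + l))) :
    ∃ n₀ : ℕ, ∀ n, n₀ ≤ n → (∀ z, ‖z‖ = midRadius l n → charFun l d l q z ≠ 0) ∧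
      ∃ Z : Finset ℂ, (∀ a, a ∈ Z ↔ ‖a‖ < midRadius l n ∧ charFun l d l q a = 0) ∧
        ∑ a ∈ Z, analyticOrderNatAt (charFun l d l q) a = n + 1 := by
  have hpi := Real.pi_pos
  obtain ⟨K, hK, hbound⟩ := exists_norm_charFun_sub_le hd hl hq₁ hq₂
  have hdiff := differentiable_charFun hl.le hd hl.le hq₁ hq₂
  have hlim : Tendsto (fun n : ℕ => Real.pi * (n + 1 / 2) / (2 * l)) atTop atTop := by
    refine Tendsto.atTop_div_const (by positivity) ?_
    refine Tendsto.const_mul_atTop Real.pi_pos ?_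
    exact tendsto_atTop_add_const_right _ _ tendsto_natCast_atTop_atTop
  obtain ⟨n₀, hn₀⟩ := eventually_atTop.1
    ((hlim.eventually_ge_atTop 1).and (hlim.eventually_gt_atTop (10 * K / d ^ 2)))
  refine ⟨n₀, fun n hn => ?_⟩
  obtain ⟨hr1, hrK⟩ := hn₀ n hn
  set r : ℝ := Real.pi * (n + 1 / 2) / (2 * l) with hr
  have hstrict : ∀ z, ‖z‖ = midRadius l n →
      ‖charFun l d l q z - (d : ℂ) ^ 2 / 2 * (z * sinRoot z (2 * l))‖ <
        ‖(d : ℂ) ^ 2 / 2 * (z * sinRoot z (2 * l))‖ := by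
    intro z hz
    obtain ⟨ρ, rfl⟩ := exists_sq_eq z
    have hρr : ‖ρ‖ = r := by
      rw [norm_pow, midRadius] at hz
      exact (sq_eq_sq₀ (norm_nonneg _) (by positivity)).1 hz
    have hρ : ρ ≠ 0 := norm_pos_iff.1 (by linarith)
    refine (hbound ρ (by linarith)).trans_lt ?_
    rw [norm_leading d l hd hρ]
    obtain ⟨m, hm⟩ := exists_int_min_mul_exp_le (2 * l * ρ)
    -- The circle keeps the distance `π / 2` from the zeros of the sine.
    have hdist : 1 ≤ ‖2 * l * ρ - m * Real.pi‖ := by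
      have h1 : ‖(2 * l * ρ : ℂ)‖ = Real.pi * (n + 1 / 2) := by
        rw [norm_mul, norm_mul, Complex.norm_ofNat, norm_real, Real.norm_of_nonneg hl.le, hρr, hr]
        field_simp
      have h2 : ‖(m * Real.pi : ℂ)‖ = Real.pi * (m.natAbs : ℝ) := by
        rw [norm_mul, norm_real, Real.norm_of_nonneg hpi.le, norm_intCast, mul_comm,
          Nat.cast_natAbs, Int.cast_abs]
      have h3 := abs_norm_sub_norm_le (2 * l * ρ : ℂ) (m * Real.pi)
      rw [h1, h2, ← mul_sub, abs_mul, abs_of_pos hpi] at h3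
      refine le_trans ?_ h3
      have h4 : 1 / 2 ≤ |(n : ℝ) + 1 / 2 - m.natAbs| := by
        rcases le_or_gt m.natAbs n with h | h
        · have : (m.natAbs : ℝ) ≤ n := by exact_mod_cast h
          refine le_trans ?_ (le_abs_self _)
          linarith
        · have : (n : ℝ) + 1 ≤ m.natAbs := by exact_mod_cast h
          refine le_trans ?_ (neg_le_abs _)
          linarith
      nlinarith [Real.pi_gt_three]
    rw [min_eq_left hdist, one_mul, abs_im_two_mul l hl.le] at hm
    set E := Real.exp (2 * l * |ρ.im|) with hE
    have hE0 : 0 < E := Real.exp_pos _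
    rw [div_lt_iff₀ (by positivity)] at hrK
    rw [hρr]
    calc K * E < (r * d ^ 2 / 10) * E := by
          gcongr
          linarith
      _ = d ^ 2 / 2 * (r * (E / 5)) := by ring
      _ ≤ d ^ 2 / 2 * (r * ‖sin (2 * l * ρ)‖) := by
          gcongr
          linarith
  have hne : ∀ z, ‖z‖ = midRadius l n → charFun l d l q z ≠ 0 := fun z hz h => by
    have := hstrict z hz
    rw [h, zero_sub, norm_neg] at this
    exact lt_irrefl _ this
  have hR : 0 < midRadius l n := by
    unfold midRadius
    positivity
  refine ⟨hne, ?_⟩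
  have hfin := finite_zeros_of_entire hdiff (hne (midRadius l n : ℂ)
    (by rw [norm_real, Real.norm_of_nonneg hR.le])) (midRadius l n)
  have hZ : ∀ a, a ∈ hfin.toFinset ↔ ‖a‖ < midRadius l n ∧ charFun l d l q a = 0 := fun a => by
    simp
  obtain ⟨W, hW, hWsum⟩ := exists_zeros_leading hd hl n
  refine ⟨hfin.toFinset, hZ, ?_⟩
  rw [← hWsum]
  refine rouche hdiff ?_ hR hstrict hZ hW
  have := differentiable_sinRoot (2 * l)
  fun_prop

lemma exists_sq_eq_re_nonneg (z : ℂ) : ∃ ρ : ℂ, ρ ^ 2 = z ∧ 0 ≤ ρ.re := by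
  obtain ⟨ρ, rfl⟩ := exists_sq_eq z
  rcases le_total 0 ρ.re with h | h
  · exact ⟨ρ, rfl, h⟩
  · exact ⟨-ρ, neg_sq ρ, by simpa using h⟩

/-- The zeros of the characteristic function, listed with their multiplicities, and the first
approximation to their roots. -/
lemma exists_spectrum_approx {d l : ℝ} (hd : 0 < d) (hl : 0 < l) {q : ℝ → ℂ}
    (hq₁ : ContinuousOn q (Icc 0 l)) (hq₂ : ContinuousOn q (Icc (l + d) (l + d + l))) :
    ∃ ev ρ : ℕ → ℂ, IsSpectrum l d l q ev ∧ (∀ n, ev n = ρ n ^ 2) ∧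
      (∀ᶠ n in atTop, charFun l d l q (ρ n ^ 2) = 0) ∧
      (fun n : ℕ => 2 * l * ρ n - Real.pi * n) =O[atTop] fun n : ℕ => ((n : ℝ))⁻¹ := by
  have hpi := Real.pi_pos
  obtain ⟨K, hK, hbound⟩ := exists_norm_charFun_sub_le hd hl hq₁ hq₂
  have hdiff := differentiable_charFun hl.le hd hl.le hq₁ hq₂
  obtain ⟨n₀, hn₀⟩ := exists_count_charFun hd hl hq₁ hq₂
  obtain ⟨ev, hev, hevn⟩ := exists_enumeration hdiff (midRadius_lt hl) (tendsto_midRadius hl) hn₀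
  choose ρ hρ hρre using fun n => exists_sq_eq_re_nonneg (ev n)
  refine ⟨ev, ρ, hev, fun n => (hρ n).symm, ?_, ?_⟩
  · filter_upwards [eventually_gt_atTop n₀] with n hn
    rw [hρ]
    exact (hevn n hn).1
  set B : ℝ := 10 * K / d ^ 2 * (4 * l / Real.pi) with hB
  have hB0 : 0 < B := by positivity
  refine Asymptotics.IsBigO.of_bound B ?_
  have hlim1 : Tendsto (fun n : ℕ => Real.pi * n / (4 * l)) atTop atTop :=
    Tendsto.atTop_div_const (by positivity)
      (Tendsto.const_mul_atTop hpi tendsto_natCast_atTop_atTop)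
  filter_upwards [eventually_gt_atTop n₀, eventually_ge_atTop 1, hlim1.eventually_ge_atTop 1,
    (tendsto_natCast_atTop_atTop (R := ℝ)).eventually_gt_atTop B] with n hn hn1 hnl hnB
  obtain ⟨h0, hlow, hup⟩ := hevn n hn
  have hnpos : (0 : ℝ) < n := by exact_mod_cast hn1
  have hn1' : (1 : ℝ) ≤ n := by exact_mod_cast hn1
  have hcast : ((n - 1 : ℕ) : ℝ) = n - 1 := by rw [Nat.cast_sub hn1, Nat.cast_one]
  rw [← hρ n, norm_pow, midRadius, sq_lt_sq₀ (by positivity) (norm_nonneg _), hcast] at hlow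
  rw [← hρ n, norm_pow, midRadius, sq_lt_sq₀ (norm_nonneg _) (by positivity)] at hup
  rw [← hρ n] at h0
  have hge : Real.pi * n / (4 * l) ≤ ‖ρ n‖ := by
    refine le_trans ?_ hlow.le
    rw [div_le_div_iff₀ (by positivity) (by positivity)]
    have : 0 < Real.pi * l := by positivity
    nlinarith
  have hρ0 : ρ n ≠ 0 := norm_pos_iff.1 (by linarith)
  have hb := hbound (ρ n) (by linarith)
  rw [h0, zero_sub, norm_neg, norm_leading d l hd hρ0] at hb
  obtain ⟨m, hm⟩ := exists_int_min_mul_exp_le (2 * l * ρ n)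
  rw [abs_im_two_mul l hl.le] at hm
  set E := Real.exp (2 * l * |(ρ n).im|) with hE
  have hE0 : 0 < E := Real.exp_pos _
  have hmin : min 1 ‖2 * l * ρ n - m * Real.pi‖ ≤ B * (n : ℝ)⁻¹ := by
    have h1 : min 1 ‖2 * l * ρ n - m * Real.pi‖ * (d ^ 2 * ‖ρ n‖) ≤ 10 * K := by
      refine le_of_mul_le_mul_right ?_ hE0
      calc min 1 ‖2 * l * ρ n - m * Real.pi‖ * (d ^ 2 * ‖ρ n‖) * E
          = (min 1 ‖2 * l * ρ n - m * Real.pi‖ * E) * (d ^ 2 * ‖ρ n‖) := by ring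
        _ ≤ 5 * ‖sin (2 * l * ρ n)‖ * (d ^ 2 * ‖ρ n‖) := by gcongr
        _ = 10 * (d ^ 2 / 2 * (‖ρ n‖ * ‖sin (2 * l * ρ n)‖)) := by ring
        _ ≤ 10 * (K * E) := by gcongr
        _ = 10 * K * E := by ring
    have h2 : min 1 ‖2 * l * ρ n - m * Real.pi‖ * (d ^ 2 * (Real.pi * n / (4 * l))) ≤ 10 * K :=
      le_trans (by gcongr) h1
    have h3 : B * (n : ℝ)⁻¹ = 10 * K / (d ^ 2 * (Real.pi * n / (4 * l))) := by
      rw [hB]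
      field_simp
    rw [h3, le_div_iff₀ (by positivity)]
    exact h2
  have hBn : B * (n : ℝ)⁻¹ < 1 := by
    rwa [← div_eq_mul_inv, div_lt_one hnpos]
  have hdist : ‖2 * l * ρ n - m * Real.pi‖ ≤ B * (n : ℝ)⁻¹ := by
    rcases min_le_iff.1 hmin with h | h
    · linarith
    · exact h
  have hnW : ‖(2 * l * ρ n : ℂ)‖ = 2 * l * ‖ρ n‖ := by
    rw [norm_mul, norm_mul, Complex.norm_ofNat, norm_real, Real.norm_of_nonneg hl.le]
  have hnm : ‖(m * Real.pi : ℂ)‖ = Real.pi * (m.natAbs : ℝ) := by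
    rw [norm_mul, norm_real, Real.norm_of_nonneg hpi.le, norm_intCast, mul_comm,
      Nat.cast_natAbs, Int.cast_abs]
  have habs := (abs_le.1 ((abs_norm_sub_norm_le (2 * l * ρ n : ℂ) (m * Real.pi)).trans hdist))
  rw [hnW, hnm] at habs
  rw [div_lt_iff₀ (by positivity)] at hlow
  rw [lt_div_iff₀ (by positivity)] at hup
  have hmn : m.natAbs = n := by
    have hpi3 := Real.pi_gt_three
    refine le_antisymm ?_ ?_
    · have h1 : Real.pi * (m.natAbs : ℝ) < Real.pi * (n + 1) := by nlinarith
      have h2 := lt_of_mul_lt_mul_left h1 hpi.le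
      exact Nat.lt_succ_iff.1 (by exact_mod_cast h2)
    · have h1 : Real.pi * (n : ℝ) < Real.pi * (m.natAbs + 1) := by nlinarith
      have h2 := lt_of_mul_lt_mul_left h1 hpi.le
      exact Nat.lt_succ_iff.1 (by exact_mod_cast h2)
  have hmn' : m = n := by
    rcases Int.natAbs_eq m with h | h
    · rw [h, hmn]
    · exfalso
      rw [hmn] at h
      have h1 := (abs_le.1 ((abs_re_le_norm _).trans hdist)).2
      rw [h] at h1
      have h2 : (2 * l * ρ n - ((-(n : ℤ) : ℤ) : ℂ) * Real.pi : ℂ).re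
          = 2 * l * (ρ n).re + n * Real.pi := by
        rw [show (2 * l * ρ n - ((-(n : ℤ) : ℤ) : ℂ) * Real.pi : ℂ)
          = ((2 * l : ℝ) : ℂ) * ρ n + ((n * Real.pi : ℝ) : ℂ) by push_cast; ring, add_re,
          re_ofReal_mul, ofReal_re]
      rw [h2] at h1
      have h3 : 0 ≤ 2 * l * (ρ n).re := mul_nonneg (by positivity) (hρre n)
      nlinarith [Real.pi_gt_three]
  rw [hmn'] at hdist
  rw [Real.norm_of_nonneg (by positivity)]
  convert hdist using 2
  push_cast
  ring

/-! ### Integration by parts and Fourier coefficients -/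

/-- Fubini's theorem on the triangle `0 ≤ τ ≤ t ≤ l`. -/
lemma integral_mul_integral_eq {f g : ℝ → ℂ} {l : ℝ} (hl : 0 ≤ l) (hf : Continuous f)
    (hg : IntegrableOn g (Ioc 0 l)) :
    ∫ t in (0 : ℝ)..l, f t * ∫ τ in (0 : ℝ)..t, g τ
      = ∫ τ in (0 : ℝ)..l, (∫ t in τ..l, f t) * g τ := by
  set μ := volume.restrict (Ioc 0 l) with hμ
  set A : Set (ℝ × ℝ) := {p | p.2 ≤ p.1} with hA
  have hAm : MeasurableSet A := measurableSet_le measurable_snd measurable_fst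
  have hfi : Integrable f μ :=
    (hf.integrableOn_Ioc : IntegrableOn f (Ioc 0 l) volume)
  have hint : Integrable (A.indicator fun p : ℝ × ℝ => f p.1 * g p.2) (μ.prod μ) :=
    (hfi.mul_prod hg).indicator hAm
  have hswap := integral_integral_swap (f := fun t τ => A.indicator (fun p => f p.1 * g p.2) (t, τ))
    (μ := μ) (ν := μ) hint
  have h1 : ∀ t ∈ Ioc 0 l, ∫ τ, A.indicator (fun p => f p.1 * g p.2) (t, τ) ∂μ
      = f t * ∫ τ in (0 : ℝ)..t, g τ := by
    intro t ht
    have h2 : (fun τ => A.indicator (fun p => f p.1 * g p.2) (t, τ))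
        = (Iic t).indicator fun τ => f t * g τ := by
      funext τ
      simp only [indicator, hA, mem_ofPred_eq, mem_Iic]
    rw [h2, integral_indicator measurableSet_Iic, hμ, Measure.restrict_restrict measurableSet_Iic,
      show Iic t ∩ Ioc 0 l = Ioc 0 t by
        ext s
        simp only [mem_inter_iff, mem_Iic, mem_Ioc]
        constructor
        · rintro ⟨h3, h4, -⟩
          exact ⟨h4, h3⟩
        · rintro ⟨h3, h4⟩
          exact ⟨h4, h3, h4.trans ht.2⟩,
      integral_const_mul, intervalIntegral.integral_of_le ht.1.le]
  have h2 : ∀ τ ∈ Ioc 0 l, ∫ t, A.indicator (fun p => f p.1 * g p.2) (t, τ) ∂μ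
      = (∫ t in τ..l, f t) * g τ := by
    intro τ hτ
    have h2 : (fun t => A.indicator (fun p => f p.1 * g p.2) (t, τ))
        = (Ici τ).indicator fun t => f t * g τ := by
      funext t
      simp only [indicator, hA, mem_ofPred_eq, mem_Ici]
    rw [h2, integral_indicator measurableSet_Ici, hμ, Measure.restrict_restrict measurableSet_Ici,
      show Ici τ ∩ Ioc 0 l = Icc τ l by
        ext s
        simp only [mem_inter_iff, mem_Ici, mem_Ioc, mem_Icc]
        constructor
        · rintro ⟨h3, -, h4⟩
          exact ⟨h3, h4⟩
        · rintro ⟨h3, h4⟩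
          exact ⟨h3, hτ.1.trans_le h3, h4⟩,
      integral_mul_const, integral_Icc_eq_integral_Ioc, intervalIntegral.integral_of_le hτ.2]
  rw [intervalIntegral.integral_of_le hl, intervalIntegral.integral_of_le hl,
    ← setIntegral_congr_fun measurableSet_Ioc h1, ← setIntegral_congr_fun measurableSet_Ioc h2]
  exact hswap

/-- Integration by parts against an absolutely continuous function. -/
lemma mul_integral_sinRoot_eq {q g : ℝ → ℂ} {l : ℝ} (hl : 0 ≤ l)
    (hg : IntegrableOn g (Ioc 0 l)) (hq : ∀ x ∈ Icc 0 l, q x = q 0 + ∫ t in (0 : ℝ)..x, g t)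
    (z : ℂ) :
    z * ∫ t in (0 : ℝ)..l, sinRoot z t * q t
      = q 0 - cosRoot z l * q l + ∫ t in (0 : ℝ)..l, cosRoot z t * g t := by
  have hs : Continuous fun t => z * sinRoot z t := continuous_const.mul (continuous_sinRoot z)
  have hc := continuous_cosRoot z
  have hprim : ∀ τ, ∫ t in τ..l, z * sinRoot z t = cosRoot z τ - cosRoot z l := by
    intro τ
    have h := intervalIntegral.integral_eq_sub_of_hasDerivAt (a := τ) (b := l)
      (f := fun t => -cosRoot z t) (f' := fun t => z * sinRoot z t)
      (fun t _ => (hasDerivAt_cosRoot z t).neg.congr_deriv (neg_neg _)) (hs.intervalIntegrable _ _)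
    rw [h]
    ring
  have hgi : IntervalIntegrable g volume 0 l := (intervalIntegrable_iff_integrableOn_Ioc_of_le hl).2 hg
  have hGc : ContinuousOn (fun x => ∫ t in (0 : ℝ)..x, g t) (uIcc 0 l) :=
    intervalIntegral.continuousOn_primitive_interval (by
      rw [uIcc_of_le hl, integrableOn_Icc_iff_integrableOn_Ioc]
      exact hg)
  have h1 : ∫ t in (0 : ℝ)..l, sinRoot z t * q t * z
      = ∫ t in (0 : ℝ)..l, (q 0 * (z * sinRoot z t) + z * sinRoot z t * ∫ τ in (0 : ℝ)..t, g τ) := by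
    refine intervalIntegral.integral_congr fun t ht => ?_
    rw [uIcc_of_le hl] at ht
    rw [hq t ht]
    ring
  have h2 : ∫ τ in (0 : ℝ)..l, (∫ t in τ..l, z * sinRoot z t) * g τ
      = (∫ t in (0 : ℝ)..l, cosRoot z t * g t) - cosRoot z l * ∫ t in (0 : ℝ)..l, g t := by
    simp only [hprim, sub_mul]
    rw [intervalIntegral.integral_sub, intervalIntegral.integral_const_mul]
    · exact hgi.continuousOn_mul hc.continuousOn
    · exact hgi.const_mul _
  rw [mul_comm, ← intervalIntegral.integral_mul_const, h1, intervalIntegral.integral_add,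
    intervalIntegral.integral_const_mul, hprim, integral_mul_integral_eq hl hs hg, h2,
    hq l ⟨hl, le_rfl⟩, cosRoot_zero]
  · ring
  · exact (hs.intervalIntegrable _ _).const_mul _
  · exact (hs.continuousOn.mul hGc).intervalIntegrable

/-- The cosine coefficients of a square integrable function on `[0, l]` with respect to the
half-integer system `cos (π n t / 2 l)` are square summable: they are the Fourier coefficients, on
an interval of length `4 l`, of its extension by zero. -/
lemma memℓp_integral_cos {g : ℝ → ℂ} {l : ℝ} (hl : 0 < l)
    (hg : MemLp g 2 (volume.restrict (Ioc 0 l))) :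
    Memℓp (fun n : ℕ => ∫ t in (0 : ℝ)..l, cos (((Real.pi * n / (2 * l) : ℝ) : ℂ) * t) * g t) 2 := by
  have h4 : (0 : ℝ) < 4 * l := by linarith
  set G : ℝ → ℂ := (Ioc 0 l).indicator g with hG
  have hGL : MemLp G 2 (volume.restrict (Ioc 0 (4 * l))) :=
    ((memLp_indicator_iff_restrict measurableSet_Ioc).2 hg).restrict _
  have hsum := (hasSum_sq_fourierCoeffOn h4 hGL).summable
  have hgi : IntegrableOn g (Ioc 0 l) := hg.integrable one_le_two
  have hcoef : ∀ n : ℤ, fourierCoeffOn h4 G n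
      = (1 / (4 * l) : ℝ) * ∫ t in (0 : ℝ)..l, exp (-(((Real.pi * n / (2 * l) : ℝ) : ℂ) * t * I)) * g t := by
    intro n
    rw [fourierCoeffOn_eq_integral, sub_zero, real_smul, intervalIntegral.integral_of_le h4.le,
      intervalIntegral.integral_of_le hl.le]
    congr 1
    have h1 : ∀ x : ℝ, (fourier (-n) (x : AddCircle (4 * l)) : ℂ) • G x
        = (Ioc 0 l).indicator (fun t : ℝ => exp (-(((Real.pi * n / (2 * l) : ℝ) : ℂ) * t * I)) * g t) x := by
      intro x
      rw [hG]
      by_cases hx : x ∈ Ioc 0 l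
      · rw [indicator_of_mem hx, indicator_of_mem hx, fourier_coe_apply, smul_eq_mul]
        congr 2
        have : (l : ℂ) ≠ 0 := by exact_mod_cast hl.ne'
        push_cast
        field_simp
        ring
      · rw [indicator_of_notMem hx, indicator_of_notMem hx, smul_zero]
    simp only [h1]
    rw [setIntegral_indicator measurableSet_Ioc, inter_eq_right.2]
    exact Ioc_subset_Ioc_right (by linarith)
  have hx : ∀ n : ℕ, ∫ t in (0 : ℝ)..l, cos (((Real.pi * n / (2 * l) : ℝ) : ℂ) * t) * g t
      = (2 * l : ℝ) * (fourierCoeffOn h4 G (n : ℤ) + fourierCoeffOn h4 G (-(n : ℤ))) := by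
    intro n
    have hgI : IntervalIntegrable g volume 0 l :=
      (intervalIntegrable_iff_integrableOn_Ioc_of_le hl.le).2 hgi
    rw [hcoef, hcoef, ← mul_add, ← intervalIntegral.integral_add
      (hgI.continuousOn_mul (by fun_prop)) (hgI.continuousOn_mul (by fun_prop)), ← mul_assoc,
      ← ofReal_mul, ← intervalIntegral.integral_const_mul]
    refine intervalIntegral.integral_congr fun t _ => ?_
    rw [cos]
    have h2 : ((2 * l * (1 / (4 * l)) : ℝ) : ℂ) = 1 / 2 := by
      rw [show (2 * l * (1 / (4 * l)) : ℝ) = 1 / 2 by field_simp; norm_num]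
      norm_num
    rw [h2]
    push_cast
    ring_nf
  simp only [hx]
  refine Memℓp.const_mul ?_ _
  have hnat : Memℓp (fun n : ℕ => fourierCoeffOn h4 G (n : ℤ)) 2 := by
    refine memℓp_gen ?_
    simp only [ENNReal.toReal_ofNat, Real.rpow_ofNat]
    exact hsum.comp_injective Nat.cast_injective
  have hneg : Memℓp (fun n : ℕ => fourierCoeffOn h4 G (-(n : ℤ))) 2 := by
    refine memℓp_gen ?_
    simp only [ENNReal.toReal_ofNat, Real.rpow_ofNat]
    exact hsum.comp_injective (i := fun n : ℕ => -(n : ℤ))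
      (neg_injective.comp Nat.cast_injective)
  exact hnat.add hneg

/-! ### Asymptotics of the zeros -/

lemma norm_sin_sub_self_le {h : ℂ} (hh : ‖h‖ ≤ 1) : ‖sin h - h‖ ≤ ‖h‖ ^ 3 := by
  have h1 := sin_bound hh
  have h2 : ‖h‖ ^ 5 ≤ ‖h‖ ^ 3 := pow_le_pow_of_le_one (norm_nonneg _) hh (by norm_num)
  have h3 : ‖h ^ 3 / 6‖ = ‖h‖ ^ 3 / 6 := by rw [norm_div, norm_pow, Complex.norm_ofNat]
  have h4 : sin h - h = (sin h - (h - h ^ 3 / 6)) - h ^ 3 / 6 := by ring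
  rw [h4]
  refine (norm_sub_le _ _).trans ?_
  rw [h3]
  have h5 : 0 ≤ ‖h‖ ^ 3 := by positivity
  linarith

lemma norm_cos_sub_one_le {h : ℂ} (hh : ‖h‖ ≤ 1) : ‖cos h - 1‖ ≤ ‖h‖ ^ 2 := by
  have h1 := cos_bound hh
  have h2 : ‖h‖ ^ 4 ≤ ‖h‖ ^ 2 := pow_le_pow_of_le_one (norm_nonneg _) hh (by norm_num)
  have h3 : ‖h ^ 2 / 2‖ = ‖h‖ ^ 2 / 2 := by rw [norm_div, norm_pow, Complex.norm_ofNat]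
  have h4 : cos h - 1 = (cos h - (1 - h ^ 2 / 2)) - h ^ 2 / 2 := by ring
  rw [h4]
  refine (norm_sub_le _ _).trans ?_
  rw [h3]
  have h5 : 0 ≤ ‖h‖ ^ 2 := by positivity
  linarith

lemma norm_sin_le_two_mul {h : ℂ} (hh : ‖h‖ ≤ 1) : ‖sin h‖ ≤ 2 * ‖h‖ := by
  have h1 := norm_sin_sub_self_le hh
  have h2 : ‖h‖ ^ 3 ≤ ‖h‖ ^ 1 := pow_le_pow_of_le_one (norm_nonneg _) hh (by norm_num)
  have h3 := norm_add_le (sin h - h) h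
  rw [sub_add_cancel] at h3
  linarith

lemma norm_cos_add_sub_cos_le (a : ℝ) {h : ℂ} (hh : ‖h‖ ≤ 1) :
    ‖cos (a + h) - cos a‖ ≤ 3 * ‖h‖ := by
  have h1 := norm_cos_sub_one_le hh
  have h2 : ‖h‖ ^ 2 ≤ ‖h‖ ^ 1 := pow_le_pow_of_le_one (norm_nonneg _) hh (by norm_num)
  have h3 := norm_sin_le_two_mul hh
  have hc : ‖cos (a : ℂ)‖ ≤ 1 := by simpa using norm_cos_le_exp_abs_im (a : ℂ)
  have hs : ‖sin (a : ℂ)‖ ≤ 1 := by simpa using norm_sin_le_exp_abs_im (a : ℂ)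
  rw [show cos (a + h) - cos a = cos a * (cos h - 1) - sin a * sin h by rw [cos_add]; ring]
  calc ‖cos (a : ℂ) * (cos h - 1) - sin a * sin h‖
      ≤ ‖cos (a : ℂ) * (cos h - 1)‖ + ‖sin (a : ℂ) * sin h‖ := norm_sub_le _ _
    _ ≤ 1 * ‖h‖ ^ 2 + 1 * (2 * ‖h‖) := by
        rw [norm_mul, norm_mul]
        gcongr
    _ ≤ 3 * ‖h‖ := by linarith

lemma norm_sin_add_sub_sin_le (a : ℝ) {h : ℂ} (hh : ‖h‖ ≤ 1) :
    ‖sin (a + h) - sin a‖ ≤ 3 * ‖h‖ := by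
  have h1 := norm_cos_add_sub_cos_le (a - Real.pi / 2) hh
  have h2 : ∀ b : ℂ, cos (b - Real.pi / 2) = sin b := cos_sub_pi_div_two
  push_cast at h1
  rwa [h2, show (a : ℂ) - Real.pi / 2 + h = (a + h) - Real.pi / 2 by ring, h2] at h1

/-- The sine vanishes at `π n / 2` for even `n`. -/
lemma neg_one_pow_mul_sin (n : ℕ) :
    (-1 : ℂ) ^ n * (Real.sin (Real.pi * n / 2) : ℂ) = -(Real.sin (Real.pi * n / 2) : ℂ) := by
  have h := Real.sin_sub_nat_mul_pi (Real.pi * n / 2) n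
  rw [show Real.pi * n / 2 - n * Real.pi = -(Real.pi * n / 2) by ring, Real.sin_neg] at h
  have h1 := congrArg ((↑) : ℝ → ℂ) h
  push_cast at h1 ⊢
  exact h1.symm

/-- The equation `charFun (ρ²) = 0`, solved for `w = 2 l ρ - π n` in the leading term. Here
`x₁` and `x₂` are the integrals of `q` over the two segments, and the equation for `ρ² x₁` is
integration by parts, with `J` the integral of the derivative of `q`. -/
lemma equation_of_charFun_eq_zero {d l : ℝ} (hd : 0 < d) (hl : 0 < l) {q : ℝ → ℂ} {n : ℕ}
    {ρ w k J x₁ x₂ δ : ℂ} (hρ : ρ ≠ 0) (hk : k ≠ 0) (hw : w = 2 * l * ρ - Real.pi * n)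
    (hρk : ρ = k + w / (2 * l)) (h0 : charFun l d l q (ρ ^ 2) = 0)
    (hx₁ : x₁ = ∫ t in (0 : ℝ)..l, sinRoot (ρ ^ 2) t * q t)
    (hx₂ : x₂ = ∫ t in (l + d)..(l + d + l), sinRoot (ρ ^ 2) (l + d + l - t) * q t)
    (hJ : ρ ^ 2 * x₁ = q 0 - cos (ρ * l) * q l + J) (hδ : (-1) ^ n * δ = -δ) :
    d ^ 2 / 2 * k * w = d + δ * d ^ 2 * q 0 / k +
      (-(d ^ 2 / 2 * (ρ * (sin w - w))) - d ^ 2 / (4 * l) * w ^ 2 + d * (cos w - 1)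
        + (1 + d ^ 2 * q l / 2) * (sin w * ρ⁻¹)
        + (-1) ^ n * (d * q l * (sin (ρ * l) * sin (ρ * l) * ρ⁻¹ * ρ⁻¹)
          + sin (ρ * l) * x₂ * ρ⁻¹ + d * (cos (ρ * l) * x₁) + sin (ρ * l) * x₁ * ρ⁻¹
          - d ^ 2 * (sin (ρ * l) * J * ρ⁻¹)
          - d ^ 2 * q 0 * ((sin (ρ * l) - δ) * ρ⁻¹ - δ * (w * ρ⁻¹ * k⁻¹ / (2 * l))))) := by
  have hlC : (l : ℂ) ≠ 0 := by exact_mod_cast hl.ne'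
  rw [charFun_eq_of_eq hd hl.le, ← hx₁, ← hx₂, sinRoot_sq hρ, sinRoot_sq hρ, cosRoot_sq] at h0
  have h2l : ρ * ((2 * l : ℝ) : ℂ) = w + n * Real.pi := by
    rw [hw]
    push_cast
    ring
  have hsin : sin (ρ * ((2 * l : ℝ) : ℂ)) = (-1) ^ n * sin w := by
    rw [h2l, sin_antiperiodic.add_nat_mul_eq n]
  have hcos : cos (ρ * ((2 * l : ℝ) : ℂ)) = (-1) ^ n * cos w := by
    rw [h2l, cos_antiperiodic.add_nat_mul_eq n]
  have hdouble : ρ * ((2 * l : ℝ) : ℂ) = 2 * (ρ * l) := by push_cast; ring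
  have hsc : 2 * sin (ρ * l) * cos (ρ * l) = (-1) ^ n * sin w := by
    rw [← hsin, hdouble, sin_two_mul]
  have hcs : cos (ρ * l) ^ 2 - sin (ρ * l) ^ 2 = (-1) ^ n * cos w := by
    rw [← hcos, hdouble, cos_two_mul']
  have hσ : ((-1 : ℂ) ^ n) * (-1) ^ n = 1 := by
    rw [← pow_add, ← two_mul, pow_mul]
    norm_num
  set σ : ℂ := (-1) ^ n with hσdef
  set S := sin (ρ * l) with hS
  set c := cos (ρ * l) with hc
  rw [hsin] at h0
  -- The difference of the two reciprocals is `w / (2 l ρ k)`.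
  have hinv : w * ρ⁻¹ * k⁻¹ / (2 * l) = k⁻¹ - ρ⁻¹ := by
    have : w = 2 * l * (ρ - k) := by
      rw [hρk]
      field_simp
      ring
    rw [this]
    field_simp
  rw [hinv]
  have hfirst : (d : ℂ) ^ 2 / 2 * (ρ ^ 2 * (σ * sin w / ρ)) = d ^ 2 / 2 * ρ * σ * sin w := by
    field_simp
  have hrest : d * ρ ^ 2 * (S / ρ) ^ 2 - d * c ^ 2 - 2 * (S / ρ) * c - d * q l * (S / ρ) ^ 2
        - S / ρ * x₂ - d * c * x₁ - S / ρ * x₁ + d ^ 2 * ρ ^ 2 * (S / ρ) * x₁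
      = -(d * (σ * cos w)) - σ * sin w * ρ⁻¹ - d * q l * (S * S * ρ⁻¹ * ρ⁻¹) - S * x₂ * ρ⁻¹
        - d * (c * x₁) - S * x₁ * ρ⁻¹
        + d ^ 2 * (S * q 0 * ρ⁻¹ - q l / 2 * (σ * sin w) * ρ⁻¹ + S * J * ρ⁻¹) := by
    have e1 : (d : ℂ) * ρ ^ 2 * (S / ρ) ^ 2 = d * S ^ 2 := by field_simp
    have e2 : (d : ℂ) ^ 2 * ρ ^ 2 * (S / ρ) * x₁ = d ^ 2 * (S * ρ⁻¹) * (ρ ^ 2 * x₁) := by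
      field_simp
    rw [e1, e2, hJ, ← hcs, ← hsc]
    field_simp
    ring
  rw [hfirst, hrest] at h0
  have hw2 : (d : ℂ) ^ 2 / (4 * l) * w ^ 2 = d ^ 2 / 2 * (ρ - k) * w := by
    rw [hρk]
    field_simp
    ring
  rw [hw2]
  have h1 := congrArg (fun x => σ * x) h0
  simp only [mul_zero] at h1
  rw [div_eq_mul_inv (δ * (d : ℂ) ^ 2 * q 0) k]
  linear_combination h1 + (-(d ^ 2 / 2 * ρ * sin w) + d * cos w + sin w * ρ⁻¹
    + d ^ 2 * q l / 2 * sin w * ρ⁻¹) * hσ - (d ^ 2 * q 0 * k⁻¹) * hδ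

/-- The second approximation to the roots of the zeros. With `w = 2 l ρ - π n`, all terms of the
equation for `w` except the two leading ones are of order `n⁻² + n⁻¹ |x|`, where `x` is the `n`-th
cosine coefficient of `q'`. -/
lemma isBigO_root_sub {d l : ℝ} (hd : 0 < d) (hl : 0 < l) {q g : ℝ → ℂ}
    (hq₂ : ContinuousOn q (Icc (l + d) (l + d + l)))
    (hg : IntegrableOn g (Ioc 0 l)) (hq : ∀ x ∈ Icc 0 l, q x = q 0 + ∫ t in (0 : ℝ)..x, g t)
    {ρ : ℕ → ℂ} (h0 : ∀ᶠ n in atTop, charFun l d l q (ρ n ^ 2) = 0)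
    (hw : (fun n : ℕ => 2 * l * ρ n - Real.pi * n) =O[atTop] fun n : ℕ => ((n : ℝ))⁻¹) :
    (fun n : ℕ => (n : ℂ) ^ 2 * (ρ n - ((Real.pi : ℂ) * n / (2 * l) + 2 / (d * Real.pi * n)
          + 4 * l * (Real.sin (Real.pi * n / 2) : ℂ) * q 0 / ((Real.pi : ℂ) ^ 2 * n ^ 2))))
      =O[atTop] fun n : ℕ => (n : ℝ)⁻¹ +
        ‖∫ t in (0 : ℝ)..l, cos (((Real.pi * n / (2 * l) : ℝ) : ℂ) * t) * g t‖ := by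
  have hpi := Real.pi_pos
  have hlC : (l : ℂ) ≠ 0 := by exact_mod_cast hl.ne'
  have hdC : (d : ℂ) ≠ 0 := by exact_mod_cast hd.ne'
  have hpiC : (Real.pi : ℂ) ≠ 0 := by exact_mod_cast hpi.ne'
  set x : ℕ → ℂ := fun n => ∫ t in (0 : ℝ)..l, cos (((Real.pi * n / (2 * l) : ℝ) : ℂ) * t) * g t
    with hx
  set w : ℕ → ℂ := fun n => 2 * l * ρ n - Real.pi * n with hwdef
  set k : ℕ → ℂ := fun n => ((Real.pi * n / (2 * l) : ℝ) : ℂ) with hk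
  set δ : ℕ → ℂ := fun n => (Real.sin (Real.pi * n / 2) : ℂ) with hδ
  set J : ℕ → ℂ := fun n => ∫ t in (0 : ℝ)..l, cosRoot (ρ n ^ 2) t * g t with hJ
  set x₁ : ℕ → ℂ := fun n => ∫ t in (0 : ℝ)..l, sinRoot (ρ n ^ 2) t * q t with hx₁
  set x₂ : ℕ → ℂ := fun n => ∫ t in (l + d)..(l + d + l), sinRoot (ρ n ^ 2) (l + d + l - t) * q t
    with hx₂
  set S : ℕ → ℂ := fun n => sin (ρ n * l) with hS
  set c : ℕ → ℂ := fun n => cos (ρ n * l) with hc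
  set r : ℕ → ℝ := fun n => (n : ℝ)⁻¹ with hr
  set e : ℕ → ℝ := fun n => r n * (r n + ‖x n‖) with he
  have hρk : ∀ n, ρ n = k n + w n / (2 * l) := by
    intro n
    simp only [hk, hwdef]
    push_cast
    field_simp
    ring
  have hr0 : Tendsto r atTop (𝓝 0) := tendsto_inv_atTop_nhds_zero_nat
  have hw0 : Tendsto w atTop (𝓝 0) := hw.trans_tendsto hr0
  have hwsmall : ∀ᶠ n in atTop, ‖w n‖ ≤ 1 := by
    have := hw0.norm
    rw [norm_zero] at this
    exact this.eventually_le_const one_pos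
  have hnpos : ∀ᶠ n : ℕ in atTop, (0 : ℝ) < n := by
    filter_upwards [eventually_gt_atTop 0] with n hn
    exact_mod_cast hn
  have hk0 : ∀ᶠ n in atTop, k n ≠ 0 := by
    filter_upwards [hnpos] with n hn
    exact ofReal_ne_zero.2 (by positivity)
  have hknorm : ∀ n : ℕ, ‖k n‖ = Real.pi * n / (2 * l) := fun n => by
    simp only [hk]
    rw [norm_real, Real.norm_of_nonneg (by positivity)]
  have h2l : ‖(2 * l : ℂ)‖ = 2 * l := by
    rw [norm_mul, Complex.norm_ofNat, norm_real, Real.norm_of_nonneg hl.le]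
  have hρge : ∀ᶠ n : ℕ in atTop, Real.pi * n / (4 * l) ≤ ‖ρ n‖ := by
    filter_upwards [hwsmall, eventually_ge_atTop 1] with n hn hn1
    have hn1' : (1 : ℝ) ≤ n := by exact_mod_cast hn1
    have h1 := norm_sub_le (ρ n) (w n / (2 * l))
    rw [show ρ n - w n / (2 * l) = k n by rw [hρk]; ring, hknorm, norm_div, h2l] at h1
    have h2 : ‖w n‖ / (2 * l) ≤ Real.pi * n / (4 * l) := by
      rw [div_le_div_iff₀ (by positivity) (by positivity)]
      have h3 : ‖w n‖ * 2 ≤ Real.pi * n := by nlinarith [Real.pi_gt_three]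
      nlinarith
    have h3 : Real.pi * n / (2 * l) = Real.pi * n / (4 * l) + Real.pi * n / (4 * l) := by
      field_simp
      ring
    linarith
  have hρ0 : ∀ᶠ n in atTop, ρ n ≠ 0 := by
    filter_upwards [hρge, hnpos] with n hn hn1
    exact norm_pos_iff.1 (lt_of_lt_of_le (by positivity) hn)
  -- Basic orders of magnitude.
  have bk : (fun n => (k n)⁻¹) =O[atTop] r := by
    refine IsBigO.of_bound (2 * l / Real.pi) ?_
    filter_upwards [hnpos] with n hn
    rw [norm_inv, hknorm, hr, norm_inv, Real.norm_of_nonneg hn.le]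
    apply le_of_eq
    field_simp
  have bρ : (fun n => (ρ n)⁻¹) =O[atTop] r := by
    refine IsBigO.of_bound (4 * l / Real.pi) ?_
    filter_upwards [hnpos, hρge] with n hn hn1
    rw [norm_inv, hr, norm_inv, Real.norm_of_nonneg hn.le]
    calc ‖ρ n‖⁻¹ ≤ (Real.pi * n / (4 * l))⁻¹ := inv_anti₀ (by positivity) hn1
      _ = 4 * l / Real.pi * (n : ℝ)⁻¹ := by field_simp
  have br1 : r =O[atTop] fun _ => (1 : ℝ) := hr0.isBigO_one ℝ
  have bw1 : w =O[atTop] fun _ => (1 : ℝ) := hw.trans br1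
  have bexp : ∀ᶠ n in atTop, Real.exp (l * |(ρ n).im|) ≤ Real.exp 1 := by
    filter_upwards [hwsmall] with n hn
    refine Real.exp_le_exp.2 ?_
    have h1 : (ρ n).im = (w n).im / (2 * l) := by
      rw [hρk]
      simp only [hk]
      rw [add_im, ofReal_im, zero_add, show (2 * l : ℂ) = ((2 * l : ℝ) : ℂ) by push_cast; rfl,
        div_ofReal_im]
    have h2 : |(w n).im| ≤ 1 := (abs_im_le_norm _).trans hn
    rw [h1, abs_div, abs_of_pos (by positivity : 0 < 2 * l)]
    calc l * (|(w n).im| / (2 * l)) = |(w n).im| / 2 := by field_simp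
      _ ≤ 1 := by linarith
  have him : ∀ n, |(ρ n * l).im| = l * |(ρ n).im| := fun n => by
    rw [im_mul_ofReal, abs_mul, abs_of_pos hl, mul_comm]
  have bS : S =O[atTop] fun _ => (1 : ℝ) := by
    refine IsBigO.of_bound (Real.exp 1) ?_
    filter_upwards [bexp] with n hn
    rw [norm_one, mul_one]
    refine (norm_sin_le_exp_abs_im _).trans ?_
    rwa [him]
  have bc : c =O[atTop] fun _ => (1 : ℝ) := by
    refine IsBigO.of_bound (Real.exp 1) ?_
    filter_upwards [bexp] with n hn
    rw [norm_one, mul_one]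
    refine (norm_cos_le_exp_abs_im _).trans ?_
    rwa [him]
  have bδ : δ =O[atTop] fun _ => (1 : ℝ) := by
    refine IsBigO.of_bound 1 (Eventually.of_forall fun n => ?_)
    simp only [hδ]
    rw [norm_real, Real.norm_eq_abs, norm_one, mul_one]
    exact Real.abs_sin_le_one _
  have bσ : (fun n : ℕ => (-1 : ℂ) ^ n) =O[atTop] fun _ => (1 : ℝ) :=
    IsBigO.of_bound 1 (Eventually.of_forall fun n => by simp)
  have bsin : (fun n => sin (w n)) =O[atTop] r := by
    refine IsBigO.trans (IsBigO.of_bound 2 ?_) hw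
    filter_upwards [hwsmall] with n hn
    exact norm_sin_le_two_mul hn
  have bcos : (fun n => cos (w n) - 1) =O[atTop] fun n => r n * r n := by
    refine IsBigO.trans (IsBigO.of_bound 1 ?_) (hw.mul hw)
    filter_upwards [hwsmall] with n hn
    rw [norm_mul, one_mul, ← sq]
    exact norm_cos_sub_one_le hn
  have bsin3 : (fun n => sin (w n) - w n) =O[atTop] fun n => r n * r n * r n := by
    refine IsBigO.trans (IsBigO.of_bound 1 ?_) ((hw.mul hw).mul hw)
    filter_upwards [hwsmall] with n hn
    rw [norm_mul, norm_mul, one_mul, show ‖w n‖ * ‖w n‖ * ‖w n‖ = ‖w n‖ ^ 3 by ring]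
    exact norm_sin_sub_self_le hn
  have bρn : ρ =O[atTop] fun n : ℕ => (n : ℝ) := by
    have h1 : k =O[atTop] fun n : ℕ => (n : ℝ) := by
      refine IsBigO.of_bound (Real.pi / (2 * l)) (Eventually.of_forall fun n => ?_)
      rw [hknorm, Real.norm_of_nonneg (by positivity)]
      apply le_of_eq
      ring
    have h2 : w =O[atTop] fun n : ℕ => (n : ℝ) := by
      refine bw1.trans (IsBigO.of_bound 1 ?_)
      filter_upwards [eventually_ge_atTop 1] with n hn
      have : (1 : ℝ) ≤ n := by exact_mod_cast hn
      rw [norm_one, one_mul, Real.norm_of_nonneg (by positivity)]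
      exact this
    have h3 : ρ = fun n => k n + (2 * l : ℂ)⁻¹ * w n := by
      funext n
      rw [hρk]
      ring
    rw [h3]
    exact h1.add (h2.const_mul_left _)
  have bre : (fun n => r n * r n) =O[atTop] e := by
    refine IsBigO.of_bound 1 (Eventually.of_forall fun n => ?_)
    have h1 : 0 ≤ r n := by simp only [hr]; positivity
    rw [one_mul, Real.norm_of_nonneg (by positivity), Real.norm_of_nonneg (by positivity)]
    simp only [he]
    gcongr
    linarith [norm_nonneg (x n)]
  have bxe : (fun n => r n * ‖x n‖) =O[atTop] e := by
    refine IsBigO.of_bound 1 (Eventually.of_forall fun n => ?_)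
    have h1 : 0 ≤ r n := by simp only [hr]; positivity
    rw [one_mul, Real.norm_of_nonneg (by positivity), Real.norm_of_nonneg (by positivity)]
    simp only [he]
    gcongr
    linarith
  -- The integrals.
  have hgI : IntervalIntegrable g volume 0 l :=
    (intervalIntegrable_iff_integrableOn_Ioc_of_le hl.le).2 hg
  have bJx : (fun n => J n - x n) =O[atTop] r := by
    refine IsBigO.trans (IsBigO.of_bound (3 * ∫ t in (0 : ℝ)..l, ‖g t‖) ?_) hw
    filter_upwards [hwsmall] with n hn
    have h1 : J n - x n = ∫ t in (0 : ℝ)..l, (cosRoot (ρ n ^ 2) t - cos (k n * t)) * g t := by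
      simp only [sub_mul, hJ, hx]
      rw [intervalIntegral.integral_sub]
      · exact hgI.continuousOn_mul (continuous_cosRoot _).continuousOn
      · exact hgI.continuousOn_mul (by fun_prop)
    have h2 : ‖J n - x n‖ ≤ ∫ t in (0 : ℝ)..l, 3 * ‖w n‖ * ‖g t‖ := by
      rw [h1]
      refine intervalIntegral.norm_integral_le_of_norm_le hl.le
        (Eventually.of_forall fun t ht => ?_) (hgI.norm.const_mul _)
      rw [norm_mul]
      gcongr
      have h3 : ρ n * t = ((Real.pi * n / (2 * l) * t : ℝ) : ℂ) + w n * (t / (2 * l) : ℝ) := by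
        rw [hρk]
        simp only [hk]
        push_cast
        field_simp
      have h4 : ‖w n * ((t / (2 * l) : ℝ) : ℂ)‖ ≤ ‖w n‖ := by
        rw [norm_mul, norm_real, Real.norm_of_nonneg (div_nonneg ht.1.le (by positivity))]
        refine mul_le_of_le_one_right (norm_nonneg _) ?_
        rw [div_le_one (by positivity)]
        linarith [ht.2]
      rw [cosRoot_sq, h3]
      have h5 := norm_cos_add_sub_cos_le (Real.pi * n / (2 * l) * t) (h4.trans hn)
      simp only [hk]
      rw [← ofReal_mul]
      linarith
    rw [intervalIntegral.integral_const_mul] at h2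
    linarith
  have bJ1 : J =O[atTop] fun _ => (1 : ℝ) := by
    refine IsBigO.of_bound (Real.exp 1 * ∫ t in (0 : ℝ)..l, ‖g t‖) ?_
    filter_upwards [bexp] with n hn
    rw [norm_one, mul_one, ← intervalIntegral.integral_const_mul]
    refine intervalIntegral.norm_integral_le_of_norm_le hl.le
      (Eventually.of_forall fun t ht => ?_) (hgI.norm.const_mul _)
    rw [norm_mul]
    gcongr
    exact (norm_cosRoot_le (ρ n) (by rw [abs_of_pos ht.1]; exact ht.2)).trans hn
  have hparts : ∀ n, ρ n ^ 2 * x₁ n = q 0 - c n * q l + J n := fun n => by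
    simp only [hx₁, hc, hJ]
    rw [mul_integral_sinRoot_eq hl.le hg hq, cosRoot_sq]
  have bx₁ : x₁ =O[atTop] fun n => r n * r n := by
    have h1 : (fun n => q 0 - c n * q l + J n) =O[atTop] fun _ => (1 : ℝ) :=
      ((isBigO_const_const (q 0) one_ne_zero _).sub
        ((bc.mul (isBigO_const_const (q l) (one_ne_zero (α := ℝ)) _)).congr_right
          fun n => one_mul _)).add bJ1
    have h2 := h1.mul (bρ.mul bρ)
    refine IsBigO.congr' h2 ?_ (Eventually.of_forall fun n => one_mul _)
    filter_upwards [hρ0] with n hn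
    rw [← hparts]
    field_simp
  have bx₂ : x₂ =O[atTop] r := by
    obtain ⟨M, hM⟩ := isCompact_Icc.exists_bound_of_continuousOn hq₂
    refine IsBigO.trans (IsBigO.of_bound (M * l * Real.exp 1) ?_) bρ
    filter_upwards [bexp, hρ0] with n hn hn1
    have hM0 : 0 ≤ M := (norm_nonneg _).trans (hM (l + d) ⟨le_rfl, by linarith⟩)
    have h1 := norm_integral_sinRoot_le hn1 (φ := fun t => l + d + l - t) (l := l) (q := q)
      (by linarith : l + d ≤ l + d + l)
      (fun t ht => by rw [abs_le]; constructor <;> linarith [ht.1, ht.2]) hM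
    rw [add_sub_cancel_left] at h1
    refine h1.trans ?_
    rw [norm_inv, mul_assoc (M * l), ← div_eq_mul_inv]
    gcongr
  have bSδ : (fun n => S n - δ n) =O[atTop] r := by
    refine IsBigO.trans (IsBigO.of_bound 3 ?_) hw
    filter_upwards [hwsmall] with n hn
    have h1 : ρ n * l = ((Real.pi * n / 2 : ℝ) : ℂ) + w n / 2 := by
      rw [hρk]
      simp only [hk]
      push_cast
      field_simp
    have h2 : ‖w n / 2‖ ≤ ‖w n‖ := by
      rw [norm_div, Complex.norm_ofNat]
      linarith [norm_nonneg (w n)]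
    have h3 := norm_sin_add_sub_sin_le (Real.pi * n / 2) (h2.trans hn)
    simp only [hS, hδ]
    rw [h1, ofReal_sin]
    linarith
  -- The terms of the remainder.
  have one_mul_r2 : ∀ {f : ℕ → ℂ}, f =O[atTop] (fun n => 1 * (r n * r n)) → f =O[atTop] e :=
    fun h => (h.congr_right fun n => one_mul _).trans bre
  have t1 : (fun n => ρ n * (sin (w n) - w n)) =O[atTop] e := by
    refine ((bρn.mul bsin3).trans ?_).trans bre
    refine IsBigO.of_bound 1 ?_
    filter_upwards [hnpos] with n hn
    rw [one_mul]
    apply le_of_eq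
    congr 1
    simp only [hr]
    field_simp
  have t2 : (fun n => w n ^ 2) =O[atTop] e := by
    simp only [sq]
    exact (hw.mul hw).trans bre
  have t3 : (fun n => cos (w n) - 1) =O[atTop] e := bcos.trans bre
  have t4 : (fun n => sin (w n) * (ρ n)⁻¹) =O[atTop] e := (bsin.mul bρ).trans bre
  have t5 : (fun n => S n * S n * (ρ n)⁻¹ * (ρ n)⁻¹) =O[atTop] e := by
    refine (((bS.mul bS).mul bρ).mul bρ).trans ?_
    simpa using bre
  have t6 : (fun n => S n * x₂ n * (ρ n)⁻¹) =O[atTop] e := by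
    refine ((bS.mul bx₂).mul bρ).trans ?_
    simpa using bre
  have t7 : (fun n => c n * x₁ n) =O[atTop] e := one_mul_r2 (bc.mul bx₁)
  have t8 : (fun n => S n * x₁ n * (ρ n)⁻¹) =O[atTop] e := by
    refine ((bS.mul bx₁).mul (bρ.trans br1)).trans ?_
    simpa using bre
  have t9 : (fun n => S n * J n * (ρ n)⁻¹) =O[atTop] e := by
    have h1 : (fun n => S n * (J n - x n) * (ρ n)⁻¹) =O[atTop] e := by
      refine ((bS.mul bJx).mul bρ).trans ?_
      simpa using bre
    have h2 : (fun n => S n * x n * (ρ n)⁻¹) =O[atTop] e := by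
      refine ((bS.mul (isBigO_refl x atTop).norm_right).mul bρ).trans ?_
      simpa [mul_comm] using bxe
    refine (h1.add h2).congr_left fun n => ?_
    ring
  have t10 : (fun n => (S n - δ n) * (ρ n)⁻¹) =O[atTop] e := (bSδ.mul bρ).trans bre
  have t11 : (fun n => δ n * (w n * (ρ n)⁻¹ * (k n)⁻¹ / (2 * l))) =O[atTop] e := by
    have h1 := (bδ.mul ((bw1.mul bρ).mul bk)).const_mul_left ((2 * l : ℂ)⁻¹)
    refine (h1.trans (by simpa using bre)).congr_left fun n => ?_
    ring
  set Err : ℕ → ℂ := fun n => -(d ^ 2 / 2 * (ρ n * (sin (w n) - w n))) - d ^ 2 / (4 * l) * w n ^ 2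
        + d * (cos (w n) - 1) + (1 + d ^ 2 * q l / 2) * (sin (w n) * (ρ n)⁻¹)
        + (-1) ^ n * (d * q l * (S n * S n * (ρ n)⁻¹ * (ρ n)⁻¹)
          + S n * x₂ n * (ρ n)⁻¹ + d * (c n * x₁ n) + S n * x₁ n * (ρ n)⁻¹
          - d ^ 2 * (S n * J n * (ρ n)⁻¹)
          - d ^ 2 * q 0 * ((S n - δ n) * (ρ n)⁻¹ - δ n * (w n * (ρ n)⁻¹ * (k n)⁻¹ / (2 * l))))
    with hErr
  have bErr : Err =O[atTop] e := by
    have hin := (((((t5.const_mul_left (d * q l)).add t6).add (t7.const_mul_left (d : ℂ))).add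
      t8).sub (t9.const_mul_left ((d : ℂ) ^ 2))).sub ((t10.sub t11).const_mul_left (d ^ 2 * q 0))
    have hin' := (bσ.mul hin).congr_right fun n => one_mul _
    exact ((((t1.const_mul_left ((d : ℂ) ^ 2 / 2)).neg_left.sub
      (t2.const_mul_left ((d : ℂ) ^ 2 / (4 * l)))).add (t3.const_mul_left (d : ℂ))).add
      (t4.const_mul_left (1 + d ^ 2 * q l / 2))).add hin'
  have hmain : ∀ᶠ n : ℕ in atTop, (2 / (d ^ 2 * Real.pi) : ℂ) * ((n : ℂ) * Err n)
      = (n : ℂ) ^ 2 * (ρ n - ((Real.pi : ℂ) * n / (2 * l) + 2 / (d * Real.pi * n)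
          + 4 * l * δ n * q 0 / ((Real.pi : ℂ) ^ 2 * n ^ 2))) := by
    filter_upwards [h0, hρ0, hk0, hnpos] with n h0n hρn hkn hn
    have hnC : (n : ℂ) ≠ 0 := by exact_mod_cast hn.ne'
    have heq := equation_of_charFun_eq_zero hd hl (n := n) hρn hkn (w := w n) (δ := δ n)
      (J := J n) (x₁ := x₁ n) (x₂ := x₂ n) rfl (hρk n) h0n rfl rfl (hparts n)
      (neg_one_pow_mul_sin n)
    have hErrn : Err n = d ^ 2 / 2 * k n * w n - d - δ n * d ^ 2 * q 0 / k n := by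
      rw [heq]
      simp only [hErr]
      ring
    have hkn' : k n = Real.pi * n / (2 * l) := by
      simp only [hk]
      push_cast
      ring
    rw [hErrn, hρk n, hkn']
    field_simp
    ring
  have hfin := (((isBigO_refl (fun n : ℕ => (n : ℝ)) atTop).mul bErr.norm_left))
  have hfin2 : (fun n : ℕ => (n : ℂ) * Err n) =O[atTop] fun n => r n + ‖x n‖ := by
    refine IsBigO.congr' (IsBigO.of_norm_left (f' := fun n : ℕ => (n : ℂ) * Err n)
      (hfin.norm_left.congr_left fun n => ?_)) EventuallyEq.rfl ?_
    · simp
    · filter_upwards [hnpos] with n hn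
      simp only [he, hr]
      field_simp
  exact (hfin2.const_mul_left _).congr' hmain EventuallyEq.rfl

/-- A sequence dominated by `n⁻¹ + |x n|` with square summable `x` is square summable. -/
lemma memℓp_two_of_isBigO {x μ : ℕ → ℂ} (hx : Memℓp x 2)
    (h : μ =O[atTop] fun n : ℕ => (n : ℝ)⁻¹ + ‖x n‖) : Memℓp μ 2 := by
  refine memℓp_gen ?_
  have hxs := hx.summable (by norm_num)
  simp only [ENNReal.toReal_ofNat, Real.rpow_ofNat] at hxs ⊢
  have hn : Summable fun n : ℕ => ((n : ℝ)⁻¹) ^ 2 := by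
    simp
  refine summable_of_isBigO_nat ((hn.add hxs).mul_left 2) ?_
  refine (h.norm_left.pow 2).trans (IsBigO.of_bound 1 (Eventually.of_forall fun n => ?_))
  rw [one_mul, Real.norm_of_nonneg (by positivity), Real.norm_of_nonneg (by positivity)]
  nlinarith [sq_nonneg ((n : ℝ)⁻¹ - ‖x n‖)]

end FrozenArgument

theorem theorem2 (γ d l : ℝ) (hd : 0 < d) (hl : 0 < l) (hcase : l = γ) (q : ℝ → ℂ)
    (hq₁ : FrozenArgument.MemW12 q 0 γ)
    (hq₂ : FrozenArgument.MemW12 q (γ + d) (γ + d + l)) :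
    Differentiable ℂ (FrozenArgument.charFun γ d l q) ∧
    (∀ z : ℂ, FrozenArgument.IsEigenvalue γ d l q z ↔ FrozenArgument.charFun γ d l q z = 0) ∧
    ∃ ev ρ μ : ℕ → ℂ,
      FrozenArgument.IsSpectrum γ d l q ev ∧
      Memℓp μ 2 ∧
      ∀ n : ℕ, 1 ≤ n →
        ev n = ρ n ^ 2 ∧
        ρ n = (Real.pi : ℂ) * n / (2 * l) + 2 / (d * Real.pi * n)
          + 4 * l * (Real.sin (Real.pi * n / 2) : ℂ) * q 0 / ((Real.pi : ℂ) ^ 2 * n ^ 2)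
          + μ n / (n : ℂ) ^ 2 := by
  subst hcase
  have hc₁ := hq₁.continuousOn hl.le
  have hc₂ := hq₂.continuousOn (by linarith)
  refine ⟨FrozenArgument.differentiable_charFun hl.le hd hl.le hc₁ hc₂,
    FrozenArgument.isEigenvalue_iff hl.le hd hl.le hc₁ hc₂, ?_⟩
  obtain ⟨g, hg, hqg⟩ := hq₁
  obtain ⟨ev, ρ, hev, hρ, h0, hw⟩ := FrozenArgument.exists_spectrum_approx hd hl hc₁ hc₂
  refine ⟨ev, ρ, _, hev, FrozenArgument.memℓp_two_of_isBigO
    (FrozenArgument.memℓp_integral_cos hl hg) (FrozenArgument.isBigO_root_sub hd hl hc₂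
      (hg.integrable one_le_two) hqg h0 hw), fun n hn => ⟨hρ n, ?_⟩⟩
  have hnC : (n : ℂ) ≠ 0 := by exact_mod_cast (by omega : n ≠ 0)
  rw [mul_div_cancel_left₀ _ (pow_ne_zero 2 hnC)]
  ring
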